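/- Let $\mathbb T^3=(-\pi,\pi]^3$ (with Lebesgue measure and addition modulo $2\pi\mathbb Z^3$), let $l_1,l_2,l_3>0$ (inverse masses) and $\mu_1,\mu_2,\mu_3>0$ (interaction energies), and put $\varepsilon(p)=\sum_{i=1}^3(1-\cos p^{(i)})$, $\varepsilon_\alpha=l_\alpha\varepsilon$, $l_{\beta\gamma}=\frac{l_\beta}{l_\beta+l_\gamma}$, $M=\sum_{\alpha}\frac1{l_\alpha}$, $m_\alpha=\frac1{l_\alpha M}$. Throughout, $(\alpha,\beta,\gamma)$ is a cyclic permutation of $(1,2,3)$. For $k\in\mathbb R^3$ the two-particle operator $h_\alpha(k)$ on $L_2(\mathbb T^3)$ is $$(h_\alpha(k)f)(q)=\big[\varepsilon_\beta(l_{\gamma\beta}k+q)+\varepsilon_\gamma(l_{\beta\gamma}k-q)\big]f(q)-\frac{\mu_\alpha}{(2\pi)^3}\int_{\mathbb T^3}f(q')\,dq'.$$ For $K\in\mathbb T^3$ the coordinates $(q_\alpha,p_\alpha)\in(\mathbb T^3)^2$ parametrize the triples of momenta in $\mathbb T^3$ with $k_1+k_2+k_3=K \pmod{2\pi\mathbb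 Z^3}$ by $k_\alpha=m_\alpha K-p_\alpha$, $k_\beta=m_\beta K+l_{\gamma\beta}p_\alpha+q_\alpha$, $k_\gamma=m_\gamma K+l_{\beta\gamma}p_\alpha-q_\alpha$ (each modulo $2\pi\mathbb Z^3$); functions of $(q_\alpha,p_\alpha)$, $\alpha=1,2,3$, are identified through this parametrization. The three-particle fiber operator on $L_2((\mathbb T^3)^2)$ is $H(K)=H_0(K)-V_1-V_2-V_3$, where, in the coordinates $(q_\alpha,p_\alpha)$, $H_0(K)$ is multiplication by $$E(K;q_\alpha,p_\alpha)=\varepsilon_\alpha(m_\alpha K-p_\alpha)+\varepsilon_\beta(m_\beta K+l_{\gamma\beta}p_\alpha+q_\alpha)+\varepsilon_\gamma(m_\gamma K+l_{\beta\gamma}p_\alpha-q_\alpha)$$ and $(V_\alpha f)(q_\alpha,p_\alpha)=\frac{\mu_\alpha}{(2\pi)^3}\int_{\mathbb T^3}f(q',p_\alpha)\,dq'$. Let $E_{\min}(K)$ and $E_{\max}(K)$ be the minimum and the maximum of $E(K;\cdot,\cdot)$ over $(\mathbb T^3)^2$. The discrete spectrum $\sigma_d(A)$ of a bounded self-adjoint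 operator $A$ is the set of the isolated points of its spectrum that are eigenvalues of finite multiplicity, and $\sigma_{ess}(A)=\sigma(A)\setminus\sigma_d(A)$. **Theorem.** For every $K\in\mathbb T^3$ (and in each of the three coordinate systems $(q_\alpha,p_\alpha)$ used to realize $H(K)$), $$\sigma_{ess}(H(K))=\bigcup_{\alpha=1}^3\ \bigcup_{p\in\mathbb T^3}\Big\{\sigma_d\big(h_\alpha((m_\beta+m_\gamma)K+p)\big)+\varepsilon_\alpha(m_\alpha K-p)\Big\}\ \cup\ [E_{\min}(K),E_{\max}(K)].$$ -/

import Mathlib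

open MeasureTheory Set
open scoped Real ENNReal

noncomputable section

namespace LatticeThreeBody

/-! ### Discrete and essential spectrum of a bounded (self-adjoint) operator -/

section Spectra

variable {E : Type*} [NormedAddCommGroup E] [InnerProductSpace ℂ E]

/-- The discrete spectrum: the isolated points of the spectrum that are eigenvalues of finite
multiplicity. -/
def discreteSpectrum (A : E →L[ℂ] E) : Set ℂ :=
  {z | (∃ r : ℝ, 0 < r ∧ spectrum ℂ A ∩ Metric.ball z r = {z}) ∧
    Module.End.HasEigenvalue (A : E →ₗ[ℂ] E) z ∧
    FiniteDimensional ℂ (Module.End.eigenspace (A : E →ₗ[ℂ] E) z)}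

/-- The essential spectrum: the complement of the discrete spectrum in the spectrum. -/
def essentialSpectrum (A : E →L[ℂ] E) : Set ℂ :=
  spectrum ℂ A \ discreteSpectrum A

end Spectra

/-! ### The torus `(-π, π]³` and its measure -/

/-- Three-dimensional momentum vectors. -/
abbrev Vec : Type := Fin 3 → ℝ

/-- The set `𝕋³ = (-π, π]³`. -/
def torus : Set Vec := Set.pi Set.univ fun _ => Set.Ioc (-π) π

/-- Lebesgue measure on `𝕋³`. -/
def torusMeasure : Measure Vec := volume.restrict torus

/-- Reduction of a momentum modulo `2πℤ³` to its representative in `(-π, π]³`. -/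
def wrap (x : Vec) : Vec := fun i => toIocMod Real.two_pi_pos (-π) (x i)

/-- `L₂(𝕋³)`. -/
abbrev L2T : Type := Lp ℂ 2 torusMeasure

/-- `L₂((𝕋³)²)`. -/
abbrev L2TT : Type := Lp ℂ 2 (torusMeasure.prod torusMeasure)

lemma torusMeasure_eq_pi :
    torusMeasure = Measure.pi fun _ : Fin 3 => (volume : Measure ℝ).restrict (Ioc (-π) π) := by
  rw [torusMeasure, torus, volume_pi, Measure.restrict_pi_pi]

instance : IsFiniteMeasure torusMeasure := by
  rw [torusMeasure_eq_pi]; infer_instance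

lemma measurable_toIocMod : Measurable (toIocMod Real.two_pi_pos (-π)) := by
  have h : toIocMod Real.two_pi_pos (-π) =
      fun x : ℝ => x + (⌊(-π + 2 * π - x) / (2 * π)⌋ : ℝ) * (2 * π) := by
    funext x
    rw [toIocMod, toIocDiv_eq_neg_floor, zsmul_eq_mul]
    push_cast; ring
  rw [h]
  fun_prop

lemma measurable_wrap : Measurable wrap :=
  measurable_pi_lambda _ fun i => measurable_toIocMod.comp (measurable_pi_apply i)

lemma wrap_mem (x : Vec) : wrap x ∈ torus := fun i _ => by
  have h := toIocMod_mem_Ioc Real.two_pi_pos (-π) (x i)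
  have e : -π + 2 * π = π := by ring
  rwa [e] at h

/-- The translations `y ↦ t + y` and the reflections `y ↦ t - y`, reduced modulo `2πℤ³`, preserve
the measure of the torus. -/
lemma measurePreserving_wrap (t : Vec) :
    MeasurePreserving (fun y => wrap (t + y)) torusMeasure torusMeasure ∧
      MeasurePreserving (fun y => wrap (t - y)) torusMeasure torusMeasure := by
  have : Fact (0 < 2 * π) := ⟨Real.two_pi_pos⟩
  have e0 : -π + 2 * π = π := by ring
  have hmk := AddCircle.measurePreserving_mk (2 * π) (-π)
  rw [e0] at hmk
  set ν : Measure ℝ := volume.restrict (Ioc (-π) π) with hν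
  let e : AddCircle (2 * π) → ℝ := fun x => (AddCircle.equivIoc (2 * π) (-π) x : ℝ)
  have hem : Measurable e :=
    measurable_subtype_coe.comp (AddCircle.measurableEquivIoc (2 * π) (-π)).measurable
  have hemk : ∀ x : ℝ, e (x : AddCircle (2 * π)) = toIocMod Real.two_pi_pos (-π) x := fun x => rfl
  have he : MeasurePreserving e volume ν := by
    refine ⟨hem, ?_⟩
    rw [← hmk.map_eq, Measure.map_map hem hmk.measurable]
    have : (e ∘ fun x : ℝ => (x : AddCircle (2 * π))) =ᵐ[ν] id := by
      filter_upwards [ae_restrict_mem measurableSet_Ioc] with x hx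
      rw [Function.comp_apply, hemk, id, toIocMod_eq_self, e0]
      exact hx
    rw [Measure.map_congr this, Measure.map_id]
  rw [torusMeasure_eq_pi]
  constructor
  · refine measurePreserving_pi (f := fun i y => toIocMod Real.two_pi_pos (-π) (t i + y)) _ _
      fun i => ?_
    have h := he.comp ((measurePreserving_add_left volume (t i : AddCircle (2 * π))).comp hmk)
    exact h
  · refine measurePreserving_pi (f := fun i y => toIocMod Real.two_pi_pos (-π) (t i - y)) _ _
      fun i => ?_
    have h := he.comp ((Measure.measurePreserving_sub_left volume (t i : AddCircle (2 * π))).comp hmk)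
    exact h

lemma measurePreserving_shear {φ : Vec → Vec} (hφ : MeasurePreserving φ torusMeasure torusMeasure)
    {g : Vec → Vec} (hg : Measurable g) :
    MeasurePreserving (fun x : Vec × Vec => (φ x.1, wrap (g x.1 + x.2)))
        (torusMeasure.prod torusMeasure) (torusMeasure.prod torusMeasure) ∧
      MeasurePreserving (fun x : Vec × Vec => (φ x.1, wrap (g x.1 - x.2)))
        (torusMeasure.prod torusMeasure) (torusMeasure.prod torusMeasure) := by
  constructor
  · exact hφ.skew_product (g := fun x y => wrap (g x + y))
      (measurable_wrap.comp ((hg.comp measurable_fst).add measurable_snd))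
      (Filter.Eventually.of_forall fun x => (measurePreserving_wrap (g x)).1.map_eq)
  · exact hφ.skew_product (g := fun x y => wrap (g x - y))
      (measurable_wrap.comp ((hg.comp measurable_fst).sub measurable_snd))
      (Filter.Eventually.of_forall fun x => (measurePreserving_wrap (g x)).2.map_eq)

lemma wrap_eq_wrap {x y : Vec} (h : ∀ i, ∃ n : ℤ, x i = y i + n * (2 * π)) : wrap x = wrap y := by
  funext i
  obtain ⟨n, hn⟩ := h i
  rw [wrap, wrap, hn, ← zsmul_eq_mul, toIocMod_add_zsmul]

lemma wrap_spec (x : Vec) (i : Fin 3) : ∃ n : ℤ, wrap x i = x i + n * (2 * π) :=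
  ⟨-toIocDiv Real.two_pi_pos (-π) (x i), by
    rw [wrap, toIocMod, zsmul_eq_mul]; push_cast; ring⟩

/-! ### Multiplication and averaging operators -/

section Operators

variable {X Y : Type*} [MeasurableSpace X] [MeasurableSpace Y] {ν : Measure X} {ρ : Measure Y}

lemma memLp_mul {g : X → ℝ} (hg : Measurable g) {C : ℝ} (hC : ∀ x, |g x| ≤ C) (f : Lp ℂ 2 ν) :
    MemLp (fun x => (g x : ℂ) * f x) 2 ν := by
  refine MemLp.of_le_mul (c := C) (Lp.memLp f)
    ((Complex.measurable_ofReal.comp hg).aestronglyMeasurable.mul (Lp.aestronglyMeasurable f)) ?_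
  refine Filter.Eventually.of_forall fun x => ?_
  rw [norm_mul, Complex.norm_real, Real.norm_eq_abs]
  exact mul_le_mul_of_nonneg_right (hC x) (norm_nonneg _)

/-- Multiplication by the bounded measurable real function `g`, as a bounded operator on `L₂`. -/
def mulOp (g : X → ℝ) (hg : Measurable g) (hb : ∃ C, ∀ x, |g x| ≤ C) :
    Lp ℂ 2 ν →L[ℂ] Lp ℂ 2 ν :=
  LinearMap.mkContinuousOfExistsBound
    { toFun := fun f => (memLp_mul hg hb.choose_spec f).toLp _
      map_add' := fun f₁ f₂ => by
        rw [← MemLp.toLp_add]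
        refine MemLp.toLp_congr _ _ ?_
        filter_upwards [Lp.coeFn_add f₁ f₂] with x hx
        simp only [hx, Pi.add_apply]; ring
      map_smul' := fun c f => by
        rw [RingHom.id_apply, ← MemLp.toLp_const_smul]
        refine MemLp.toLp_congr _ _ ?_
        filter_upwards [Lp.coeFn_smul c f] with x hx
        simp only [hx, Pi.smul_apply, smul_eq_mul]; ring }
    (by
      obtain ⟨C, hC⟩ := hb
      refine ⟨C, fun f => Lp.norm_le_mul_norm_of_ae_le_mul ?_⟩
      filter_upwards [MemLp.coeFn_toLp (memLp_mul hg hC f)] with x hx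
      simp only [LinearMap.coe_mk, AddHom.coe_mk, hx, norm_mul, Complex.norm_real, Real.norm_eq_abs]
      exact mul_le_mul_of_nonneg_right (hC x) (norm_nonneg _))

lemma mulOp_apply (g : X → ℝ) (hg : Measurable g) (hb : ∃ C, ∀ x, |g x| ≤ C) (f : Lp ℂ 2 ν) :
    mulOp g hg hb f =ᵐ[ν] fun x => (g x : ℂ) * f x :=
  MemLp.coeFn_toLp (memLp_mul hg hb.choose_spec f)

lemma enorm_integral_le [IsFiniteMeasure ν] {f : X → ℂ} (hf : AEStronglyMeasurable f ν) :
    ‖∫ x, f x ∂ν‖ₑ ^ 2 ≤ ν univ * ∫⁻ x, ‖f x‖ₑ ^ 2 ∂ν := by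
  have h1 : ‖∫ x, f x ∂ν‖ₑ ≤ eLpNorm f 1 ν := by
    rw [eLpNorm_one_eq_lintegral_enorm]; exact enorm_integral_le_lintegral_enorm f
  have h2 := h1.trans
    (eLpNorm_le_eLpNorm_mul_rpow_measure_univ (p := 1) (q := 2) (by norm_num) hf)
  have h3 : eLpNorm f 2 ν ^ 2 = ∫⁻ x, ‖f x‖ₑ ^ 2 ∂ν := by
    have := eLpNorm_nnreal_pow_eq_lintegral (μ := ν) (f := f) (p := 2) (by norm_num)
    simpa using this
  calc ‖∫ x, f x ∂ν‖ₑ ^ 2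
      ≤ (eLpNorm f 2 ν * ν univ ^ (1 / (1 : ℝ≥0∞).toReal - 1 / (2 : ℝ≥0∞).toReal)) ^ 2 :=
        pow_le_pow_left' h2 2
    _ = ν univ * ∫⁻ x, ‖f x‖ₑ ^ 2 ∂ν := by
        rw [mul_pow, h3, mul_comm]
        congr 1
        rw [← ENNReal.rpow_natCast, ← ENNReal.rpow_mul]
        norm_num

lemma memLp_avgFst [IsFiniteMeasure ν] [IsFiniteMeasure ρ] (f : Lp ℂ 2 (ν.prod ρ)) :
    MemLp (fun x : X × Y => ∫ q, f (q, x.2) ∂ν) 2 (ν.prod ρ) ∧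
      eLpNorm (fun x : X × Y => ∫ q, f (q, x.2) ∂ν) 2 (ν.prod ρ) ≤
        ν univ * eLpNorm f 2 (ν.prod ρ) := by
  have hsm : AEStronglyMeasurable (fun x : X × Y => ∫ q, f (q, x.2) ∂ν) (ν.prod ρ) :=
    ((Lp.aestronglyMeasurable f).prod_swap.integral_prod_right').comp_snd
  have pow2 : ∀ g : X × Y → ℂ,
      eLpNorm g 2 (ν.prod ρ) ^ 2 = ∫⁻ x, ‖g x‖ₑ ^ 2 ∂(ν.prod ρ) := fun g => by
    simpa using eLpNorm_nnreal_pow_eq_lintegral (μ := ν.prod ρ) (f := g) (p := 2) (by norm_num)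
  have hle : eLpNorm (fun x : X × Y => ∫ q, f (q, x.2) ∂ν) 2 (ν.prod ρ) ≤
      ν univ * eLpNorm f 2 (ν.prod ρ) := by
    rw [← ENNReal.pow_le_pow_left_iff (n := 2) (by norm_num), mul_pow, pow2, pow2]
    have hfm : AEMeasurable (fun x => ‖f x‖ₑ ^ 2) (ν.prod ρ) :=
      (Lp.aestronglyMeasurable f).enorm.pow_const 2
    rw [lintegral_prod_symm _ hfm, lintegral_prod_symm _ (hsm.enorm.pow_const 2)]
    simp only [lintegral_const]
    rw [lintegral_mul_const' _ _ (measure_ne_top ν univ), sq (ν univ), mul_comm, mul_assoc]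
    refine mul_le_mul_right ?_ _
    rw [← lintegral_const_mul' _ _ (measure_ne_top ν univ)]
    refine lintegral_mono_ae ?_
    have hs : ∀ᵐ y ∂ρ, AEStronglyMeasurable (fun q => f (q, y)) ν :=
      (Lp.aestronglyMeasurable f).prod_swap.prodMk_left
    filter_upwards [hs] with y hy
    exact enorm_integral_le hy
  exact ⟨⟨hsm, hle.trans_lt (ENNReal.mul_lt_top (measure_lt_top ν univ) (Lp.eLpNorm_lt_top f))⟩,
    hle⟩

lemma ae_integrable_slice [IsFiniteMeasure ν] [IsFiniteMeasure ρ] (f : Lp ℂ 2 (ν.prod ρ)) :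
    ∀ᵐ x ∂(ν.prod ρ), Integrable (fun q => f (q, x.2)) ν := by
  have h : Integrable f (ν.prod ρ) := (Lp.memLp f).integrable (by norm_num)
  exact Measure.quasiMeasurePreserving_snd.ae h.prod_left_ae

lemma ae_slice [IsFiniteMeasure ν] [IsFiniteMeasure ρ] {P : X × Y → Prop}
    (h : ∀ᵐ x ∂(ν.prod ρ), P x) : ∀ᵐ x ∂(ν.prod ρ), ∀ᵐ q ∂ν, P (q, x.2) :=
  Measure.quasiMeasurePreserving_snd.ae
    (Measure.ae_ae_of_ae_prod (Measure.measurePreserving_swap.quasiMeasurePreserving.ae h))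

/-- Integration over the first variable, as a bounded operator on `L₂(X × Y)`:
`(A f)(q, p) = ∫ f(q', p) dq'`. -/
def avgFst [IsFiniteMeasure ν] [IsFiniteMeasure ρ] : Lp ℂ 2 (ν.prod ρ) →L[ℂ] Lp ℂ 2 (ν.prod ρ) :=
  LinearMap.mkContinuous
    { toFun := fun f => (memLp_avgFst f).1.toLp _
      map_add' := fun f₁ f₂ => by
        rw [← MemLp.toLp_add]
        refine MemLp.toLp_congr _ _ ?_
        filter_upwards [ae_slice (Lp.coeFn_add f₁ f₂), ae_integrable_slice f₁,
          ae_integrable_slice f₂] with x hx h₁ h₂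
        rw [integral_congr_ae hx, Pi.add_apply, ← integral_add h₁ h₂]
        rfl
      map_smul' := fun c f => by
        rw [RingHom.id_apply, ← MemLp.toLp_const_smul]
        refine MemLp.toLp_congr _ _ ?_
        filter_upwards [ae_slice (Lp.coeFn_smul c f)] with x hx
        rw [integral_congr_ae hx, Pi.smul_apply, ← integral_smul]
        rfl }
    (ν univ).toReal
    (fun f => by
      rw [LinearMap.coe_mk, AddHom.coe_mk, Lp.norm_toLp, Lp.norm_def, ← ENNReal.toReal_mul]
      exact ENNReal.toReal_mono
        (ENNReal.mul_ne_top (measure_ne_top ν univ) (Lp.eLpNorm_ne_top f)) (memLp_avgFst f).2)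

lemma avgFst_apply [IsFiniteMeasure ν] [IsFiniteMeasure ρ] (f : Lp ℂ 2 (ν.prod ρ)) :
    avgFst f =ᵐ[ν.prod ρ] fun x => ∫ q, f (q, x.2) ∂ν :=
  MemLp.coeFn_toLp (memLp_avgFst f).1

/-- Integration over the whole space, as a bounded operator on `L₂(X)`: `A f` is the constant
function `∫ f(q') dq'`. -/
def avg [IsFiniteMeasure ν] : Lp ℂ 2 ν →L[ℂ] Lp ℂ 2 ν :=
  (Lp.constL 2 ν ℂ).comp
    (LinearMap.mkContinuousOfExistsBound
      { toFun := fun f : Lp ℂ 2 ν => ∫ q, f q ∂ν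
        map_add' := fun f₁ f₂ => by
          rw [integral_congr_ae (Lp.coeFn_add f₁ f₂), ← integral_add
            ((Lp.memLp f₁).integrable (by norm_num)) ((Lp.memLp f₂).integrable (by norm_num))]
          rfl
        map_smul' := fun c f => by
          rw [integral_congr_ae (Lp.coeFn_smul c f), RingHom.id_apply, ← integral_smul]
          rfl }
      (by
        refine ⟨((ν univ) ^ (1 / (1 : ℝ≥0∞).toReal - 1 / (2 : ℝ≥0∞).toReal)).toReal, fun f => ?_⟩
        have h1 : ‖∫ x, f x ∂ν‖ₑ ≤ eLpNorm f 1 ν := by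
          rw [eLpNorm_one_eq_lintegral_enorm]; exact enorm_integral_le_lintegral_enorm f
        have h2 := h1.trans (eLpNorm_le_eLpNorm_mul_rpow_measure_univ (p := 1) (q := 2)
          (by norm_num) (Lp.aestronglyMeasurable f))
        have h3 := ENNReal.toReal_mono (ENNReal.mul_ne_top (Lp.eLpNorm_ne_top f)
          (ENNReal.rpow_ne_top_of_nonneg (by norm_num) (measure_ne_top ν univ))) h2
        rw [ENNReal.toReal_mul, toReal_enorm, ← Lp.norm_def, mul_comm] at h3
        exact h3))

lemma avg_apply [IsFiniteMeasure ν] (f : Lp ℂ 2 ν) :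
    avg f =ᵐ[ν] fun _ => ∫ q, f q ∂ν :=
  Lp.coeFn_const (p := 2) (μ := ν) (∫ q, f q ∂ν)

end Operators

/-! ### The three-particle system -/

/-- The data of the system: `l i > 0` is the inverse mass of the particle `i`, and `μ i > 0` is the
interaction energy of the pair of the two other particles. The particles are numbered by
`Fin 3`; the cyclic triple starting at `a` is `(a, a + 1, a + 2)`. -/
structure System where
  l : Fin 3 → ℝ
  μ : Fin 3 → ℝ
  l_pos : ∀ i, 0 < l i
  μ_pos : ∀ i, 0 < μ i

/-- The dispersion function `ε(p) = ∑ᵢ (1 - cos pᵢ)`. -/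
def dispersion (p : Vec) : ℝ := ∑ i, (1 - Real.cos (p i))

lemma continuous_dispersion : Continuous dispersion := by
  unfold dispersion; fun_prop

lemma abs_dispersion_le (p : Vec) : |dispersion p| ≤ 6 := by
  have h : ∀ i, 0 ≤ 1 - Real.cos (p i) ∧ 1 - Real.cos (p i) ≤ 2 := fun i =>
    ⟨by linarith [Real.cos_le_one (p i)], by linarith [Real.neg_one_le_cos (p i)]⟩
  rw [dispersion, Fin.sum_univ_three, abs_le]
  constructor <;> linarith [h 0, h 1, h 2]

namespace System

variable (S : System)

/-- `ε_i = l_i ε`. -/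
def eps (i : Fin 3) (p : Vec) : ℝ := S.l i * dispersion p

/-- `l_{bc} = l_b / (l_b + l_c)`. -/
def lfrac (b c : Fin 3) : ℝ := S.l b / (S.l b + S.l c)

/-- The total mass `M = ∑ᵢ 1 / l_i`. -/
def totalMass : ℝ := ∑ i, 1 / S.l i

/-- `m_i = 1 / (l_i M)`. -/
def m (i : Fin 3) : ℝ := 1 / (S.l i * S.totalMass)

lemma continuous_eps (i : Fin 3) : Continuous (S.eps i) :=
  continuous_const.mul continuous_dispersion

lemma abs_eps_le (i : Fin 3) (p : Vec) : |S.eps i p| ≤ S.l i * 6 := by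
  rw [eps, abs_mul, abs_of_pos (S.l_pos i)]
  exact mul_le_mul_of_nonneg_left (abs_dispersion_le p) (S.l_pos i).le

/-! ### The two-particle operators -/

/-- `E_k^{(a)}(q) = ε_b(l_{cb} k + q) + ε_c(l_{bc} k - q)`, where `(a, b, c)` is cyclic. -/
def E₂ (a : Fin 3) (k q : Vec) : ℝ :=
  S.eps (a + 1) (S.lfrac (a + 2) (a + 1) • k + q) + S.eps (a + 2) (S.lfrac (a + 1) (a + 2) • k - q)

lemma continuous_E₂ (a : Fin 3) (k : Vec) : Continuous (S.E₂ a k) :=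
  ((S.continuous_eps _).comp (by fun_prop)).add ((S.continuous_eps _).comp (by fun_prop))

lemma exists_E₂_le (a : Fin 3) (k : Vec) : ∃ C, ∀ q, |S.E₂ a k q| ≤ C :=
  ⟨S.l (a + 1) * 6 + S.l (a + 2) * 6, fun _ =>
    (abs_add_le _ _).trans (add_le_add (S.abs_eps_le _ _) (S.abs_eps_le _ _))⟩

/-- The two-particle operator `h_a(k) = h_a⁰(k) - v_a` on `L₂(𝕋³)`: multiplication by `E_k^{(a)}`
minus `(v_a f)(q) = μ_a (2π)⁻³ ∫ f(q') dq'`. -/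
def h (a : Fin 3) (k : Vec) : L2T →L[ℂ] L2T :=
  mulOp (S.E₂ a k) (S.continuous_E₂ a k).measurable (S.exists_E₂_le a k)
    - ((S.μ a / (2 * π) ^ 3 : ℝ) : ℂ) • avg

/-! ### The three-particle fiber operators -/

/-- The kinetic energy
`E(K; q, p) = ε_a(m_a K - p) + ε_b(m_b K + l_{cb} p + q) + ε_c(m_c K + l_{bc} p - q)` in the
coordinates `(q, p) = (q_a, p_a)`, where `(a, b, c)` is cyclic. -/
def E₃ (K : Vec) (a : Fin 3) (x : Vec × Vec) : ℝ :=
  S.eps a (S.m a • K - x.2)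
    + S.eps (a + 1) (S.m (a + 1) • K + S.lfrac (a + 2) (a + 1) • x.2 + x.1)
    + S.eps (a + 2) (S.m (a + 2) • K + S.lfrac (a + 1) (a + 2) • x.2 - x.1)

lemma continuous_E₃ (K : Vec) (a : Fin 3) : Continuous (S.E₃ K a) :=
  (((S.continuous_eps _).comp (by fun_prop)).add ((S.continuous_eps _).comp (by fun_prop))).add
    ((S.continuous_eps _).comp (by fun_prop))

lemma exists_E₃_le (K : Vec) (a : Fin 3) : ∃ C, ∀ x, |S.E₃ K a x| ≤ C :=
  ⟨S.l a * 6 + S.l (a + 1) * 6 + S.l (a + 2) * 6, fun _ =>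
    (abs_add_le _ _).trans (add_le_add
      ((abs_add_le _ _).trans (add_le_add (S.abs_eps_le _ _) (S.abs_eps_le _ _)))
      (S.abs_eps_le _ _))⟩

/-- `E_min(K)`, the minimum of the kinetic energy over `(𝕋³)²`. -/
def Emin (K : Vec) (a : Fin 3) : ℝ := sInf (S.E₃ K a '' (torus ×ˢ torus))

/-- `E_max(K)`, the maximum of the kinetic energy over `(𝕋³)²`. -/
def Emax (K : Vec) (a : Fin 3) : ℝ := sSup (S.E₃ K a '' (torus ×ˢ torus))

/-- The particle momenta `(k_0, k_1, k_2)`, with sum `K` modulo `2πℤ³`, of the point with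
coordinates `(q, p) = (q_a, p_a)`. -/
def chart (K : Vec) (a : Fin 3) (x : Vec × Vec) (i : Fin 3) : Vec :=
  if i = a then wrap (S.m a • K - x.2)
  else if i = a + 1 then wrap (S.m (a + 1) • K + S.lfrac (a + 2) (a + 1) • x.2 + x.1)
  else wrap (S.m (a + 2) • K + S.lfrac (a + 1) (a + 2) • x.2 - x.1)

/-- The second coordinate `p_b` of the point with particle momenta `k`. -/
def pCoord (K : Vec) (b : Fin 3) (k : Fin 3 → Vec) : Vec := wrap (S.m b • K - k b)

/-- The first coordinate `q_b` of the point with particle momenta `k`. -/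
def qCoord (K : Vec) (b : Fin 3) (k : Fin 3 → Vec) : Vec :=
  wrap (k (b + 1) - S.m (b + 1) • K - S.lfrac (b + 2) (b + 1) • S.pCoord K b k)

/-- The coordinates `(q_b, p_b)` as functions of the coordinates `(q_a, p_a)`. -/
def chartChange (K : Vec) (a b : Fin 3) (x : Vec × Vec) : Vec × Vec :=
  (S.qCoord K b (S.chart K a x), S.pCoord K b (S.chart K a x))

lemma lfrac_add (b c : Fin 3) : S.lfrac b c + S.lfrac c b = 1 := by
  have := S.l_pos b; have := S.l_pos c
  unfold lfrac; rw [add_comm (S.l c) (S.l b)]; field_simp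

lemma m_add (a : Fin 3) : S.m a + S.m (a + 1) + S.m (a + 2) = 1 := by
  have h0 := S.l_pos 0; have h1 := S.l_pos 1; have h2 := S.l_pos 2
  have h : S.m 0 + S.m 1 + S.m 2 = 1 := by
    have hM : S.totalMass = 1 / S.l 0 + 1 / S.l 1 + 1 / S.l 2 := by
      rw [totalMass, Fin.sum_univ_three]
    have hp : 0 < S.totalMass := by rw [hM]; positivity
    have : S.m 0 + S.m 1 + S.m 2 = (1 / S.l 0 + 1 / S.l 1 + 1 / S.l 2) / S.totalMass := by
      unfold m; field_simp
    rw [this, ← hM, div_self hp.ne']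
  fin_cases a <;> simp only [Fin.isValue, Fin.zero_eta, Fin.mk_one, Fin.reduceFinMk, Fin.reduceAdd,
    zero_add] <;> linarith

/-- The particle momenta add up to `K` modulo `2πℤ³`. -/
lemma chart_add_two (K : Vec) (a i : Fin 3) (x : Vec × Vec) :
    S.chart K a x (i + 2) = wrap (K - S.chart K a x i - S.chart K a x (i + 1)) := by
  have hne : ∀ a : Fin 3, a + 1 ≠ a ∧ a + 2 ≠ a ∧ a + 2 ≠ a + 1 := by decide
  have h0 : S.chart K a x a = wrap (S.m a • K - x.2) := by simp [chart]
  have h1 : S.chart K a x (a + 1) =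
      wrap (S.m (a + 1) • K + S.lfrac (a + 2) (a + 1) • x.2 + x.1) := by
    simp [chart, hne a]
  have h2 : S.chart K a x (a + 2) =
      wrap (S.m (a + 2) • K + S.lfrac (a + 1) (a + 2) • x.2 - x.1) := by
    simp [chart, hne a]
  have hm := S.m_add a
  have hl := S.lfrac_add (a + 1) (a + 2)
  have key : ∀ j, ((S.m a • K - x.2) + (S.m (a + 1) • K + S.lfrac (a + 2) (a + 1) • x.2 + x.1)
      + (S.m (a + 2) • K + S.lfrac (a + 1) (a + 2) • x.2 - x.1)) j = K j := fun j => by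
    simp only [Pi.add_apply, Pi.sub_apply, Pi.smul_apply, smul_eq_mul]
    linear_combination (K j) * hm + (x.2 j) * hl
  have gen : ∀ u v w : Vec, (∀ j, (u + v + w) j = K j) → wrap w = wrap (K - wrap u - wrap v) := by
    intro u v w huv
    refine wrap_eq_wrap fun j => ?_
    obtain ⟨n, hn⟩ := wrap_spec u j
    obtain ⟨n', hn'⟩ := wrap_spec v j
    refine ⟨n + n', ?_⟩
    have := huv j
    simp only [Pi.add_apply, Pi.sub_apply] at this ⊢
    rw [hn, hn', ← this]; push_cast; ring
  have hi : ∀ a i : Fin 3, i = a ∨ i = a + 1 ∨ i = a + 2 := by decide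
  have e1 : ∀ a : Fin 3, a + 1 + 2 = a ∧ a + 1 + 1 = a + 2 ∧ a + 2 + 2 = a + 1 ∧ a + 2 + 1 = a := by
    decide
  obtain ⟨e1, e2, e3, e4⟩ := e1 a
  rcases hi a i with rfl | rfl | rfl
  · rw [h0, h1, h2]; exact gen _ _ _ key
  · rw [e1, e2, h0, h1, h2]
    exact gen _ _ _ fun j => by rw [← key j]; simp only [Pi.add_apply]; ring
  · rw [e3, e4, h0, h1, h2]
    exact gen _ _ _ fun j => by rw [← key j]; simp only [Pi.add_apply]; ring

lemma measurePreserving_chart (K : Vec) (a b : Fin 3) :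
    MeasurePreserving (fun x => (S.chart K a x b, S.chart K a x (b + 1)))
      (torusMeasure.prod torusMeasure) (torusMeasure.prod torusMeasure) := by
  have hne : ∀ a : Fin 3, a + 1 ≠ a ∧ a + 1 + 2 = a ∧ a + 1 + 1 = a + 2 := by decide
  have step : ∀ i, MeasurePreserving (fun x => (S.chart K a x i, S.chart K a x (i + 1)))
      (torusMeasure.prod torusMeasure) (torusMeasure.prod torusMeasure) →
      MeasurePreserving (fun x => (S.chart K a x (i + 1), S.chart K a x (i + 1 + 1)))
      (torusMeasure.prod torusMeasure) (torusMeasure.prod torusMeasure) := by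
    intro i h
    have h' := ((measurePreserving_shear (MeasurePreserving.id torusMeasure)
      (g := fun y => K - y) (by fun_prop)).2.comp Measure.measurePreserving_swap).comp h
    convert h' using 2 with x
    simp only [Function.comp_apply, Prod.swap_prod_mk, id, Prod.mk.injEq, true_and]
    rw [(hne i).2.2, S.chart_add_two, sub_right_comm]
  have base : MeasurePreserving (fun x => (S.chart K a x a, S.chart K a x (a + 1)))
      (torusMeasure.prod torusMeasure) (torusMeasure.prod torusMeasure) := by
    have h' := (measurePreserving_shear (measurePreserving_wrap (S.m a • K)).2
      (g := fun p => S.m (a + 1) • K + S.lfrac (a + 2) (a + 1) • p) (by fun_prop)).1.comp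
      Measure.measurePreserving_swap
    convert h' using 2 with x
    simp [chart, (hne a).1]
  have hb : ∀ a b : Fin 3, b = a ∨ b = a + 1 ∨ b = a + 1 + 1 := by decide
  rcases hb a b with rfl | rfl | rfl
  · exact base
  · exact step _ base
  · exact step _ (step _ base)

/-- The change of coordinates preserves the measure of `(𝕋³)²`. -/
lemma measurePreserving_chartChange (K : Vec) (a b : Fin 3) :
    MeasurePreserving (S.chartChange K a b)
      (torusMeasure.prod torusMeasure) (torusMeasure.prod torusMeasure) := by
  have h := Measure.measurePreserving_swap.comp ((measurePreserving_shear
    (measurePreserving_wrap (S.m b • K)).2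
    (g := fun k => -(S.m (b + 1) • K) - S.lfrac (b + 2) (b + 1) • wrap (S.m b • K - k)) (by
      have := measurable_wrap; fun_prop)).1.comp (S.measurePreserving_chart K a b))
  convert h using 1
  funext x
  refine Prod.ext ?_ rfl
  change wrap _ = wrap _
  congr 1
  change S.chart K a x (b + 1) - S.m (b + 1) • K - S.lfrac (b + 2) (b + 1) •
      wrap (S.m b • K - S.chart K a x b) = -(S.m (b + 1) • K) - S.lfrac (b + 2) (b + 1) •
      wrap (S.m b • K - S.chart K a x b) + S.chart K a x (b + 1)
  abel

/-- The unitary change of coordinates `(U f)(q_a, p_a) = f(q_b, p_b)`, from functions of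
`(q_b, p_b)` to functions of `(q_a, p_a)`. -/
def coordChange (K : Vec) (a b : Fin 3) : L2TT →L[ℂ] L2TT :=
  (Lp.compMeasurePreservingₗᵢ ℂ (S.chartChange K a b)
    (S.measurePreserving_chartChange K a b)).toContinuousLinearMap

/-- The interaction `V_b`, in its own coordinates `(q, p) = (q_b, p_b)`:
`(V_b f)(q, p) = μ_b (2π)⁻³ ∫ f(q', p) dq'`. -/
def Vown (b : Fin 3) : L2TT →L[ℂ] L2TT :=
  ((S.μ b / (2 * π) ^ 3 : ℝ) : ℂ) • avgFst

/-- The interaction `V_b`, in the coordinates `(q_a, p_a)`. -/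
def V (K : Vec) (a b : Fin 3) : L2TT →L[ℂ] L2TT :=
  S.coordChange K a b ∘L S.Vown b ∘L S.coordChange K b a

/-- The three-particle fiber operator `H(K) = H₀(K) - V_1 - V_2 - V_3` on `L₂((𝕋³)²)`, in the
coordinates `(q_a, p_a)`, where `H₀(K)` is the multiplication by the kinetic energy. -/
def H (K : Vec) (a : Fin 3) : L2TT →L[ℂ] L2TT :=
  mulOp (S.E₃ K a) (S.continuous_E₃ K a).measurable (S.exists_E₃_le K a) - ∑ b, S.V K a b

end System

end LatticeThreeBody

/-! Weyl's criterion carries both inclusions: a spectral value `t` is essential exactly when some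
weakly null sequence of unit vectors is asymptotically an eigenvector for `t`
(`mem_essentialSpectrum_of_weaklyNull`, `mem_discreteSpectrum_of_no_weaklyNull`).

Upper inclusion. Let `t` lie outside the band and all two-particle branches, and let `u n` be such a
sequence for `H(K)`. Multiplication by `(E₃ - t)⁻¹` is then a bounded operator `R`. In the
coordinates of the pair `b`, apply `R` and then the average over `q` to `(H - t) u n → 0`. For `c ≠
b` and fixed `p_b`, the momentum `p_c` is a translate or a reflection of `q_b`, so averaging against
`R V_c` sends bounded weakly null sequences to norm null ones (`tendsto_avgFst_mulOp_comp`). What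
remains is the average of `u n`, multiplied by the Fredholm determinant `1 - coupling * ∫ (E₃ - t)⁻¹
dq`, a function of `p` alone. A zero of it would put `t` on a branch (`mem_discreteSpectrum_h`). By
continuity and periodicity it is therefore bounded away from zero, so `V_b (u n) → 0` for every `b`
(`tendsto_Vown`). Then `(H₀ - t) u n → 0`, which is impossible off the band.

Lower inclusion. Multiply a fixed function by `exp (i n ∑ d_j k_j⁽¹⁾)` with integers `d_j`. By the
Riemann-Lebesgue lemma the result is weakly null unless the `d_j` are all equal, and `V_c` kills it
asymptotically when `d (c + 1) ≠ d (c + 2)`. Three distinct `d_j` switch off every interaction and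
give the band. Modulating only the particle `b` keeps `V_b` and switches off the two others; applied
to an eigenfunction of `h_b` times a cutoff in `p`, this gives the branches. -/

namespace LatticeThreeBody

open Filter Topology
open scoped InnerProductSpace

/-! ### Weyl's criterion for bounded self-adjoint operators. -/

section Weyl

variable {E : Type*} [NormedAddCommGroup E] [InnerProductSpace ℂ E]

/-- A sequence converges weakly to zero. -/
def WeaklyNull (f : ℕ → E) : Prop := ∀ v : E, Tendsto (fun n => ⟪v, f n⟫_ℂ) atTop (𝓝 0)

/-- By Bessel's inequality the squared coefficients of any vector are summable. -/
lemma _root_.Orthonormal.weaklyNull {f : ℕ → E} (hf : Orthonormal ℂ f) : WeaklyNull f := by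
  intro v
  have h := (hf.inner_products_summable (x := v)).tendsto_atTop_zero
  have h2 : Tendsto (fun n => ‖⟪f n, v⟫_ℂ‖) atTop (𝓝 0) := by
    have := h.sqrt
    simpa using this
  rw [tendsto_zero_iff_norm_tendsto_zero]
  simpa [norm_inner_symm] using h2

/-- A weakly null sequence in a subspace of finite dimension converges to zero. -/
lemma WeaklyNull.tendsto_of_finiteDimensional {f : ℕ → E} (hf : WeaklyNull f)
    (N : Submodule ℂ E) [FiniteDimensional ℂ N] (hN : ∀ n, f n ∈ N) :
    Tendsto f atTop (𝓝 0) := by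
  let b := stdOrthonormalBasis ℂ N
  have h : ∀ n, f n = ∑ i, ⟪(b i : E), f n⟫_ℂ • (b i : E) := fun n => by
    have := congrArg (Subtype.val) (b.sum_repr' ⟨f n, hN n⟩)
    simpa using this.symm
  have h2 : Tendsto (fun n => ∑ i, ⟪(b i : E), f n⟫_ℂ • (b i : E)) atTop
      (𝓝 (∑ i, (0 : ℂ) • (b i : E))) :=
    tendsto_finsetSum _ fun i _ => (hf (b i)).smul_const _
  simp only [zero_smul, Finset.sum_const_zero] at h2
  exact h2.congr fun n => (h n).symm

variable [CompleteSpace E]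

lemma WeaklyNull.map {F : Type*} [NormedAddCommGroup F] [InnerProductSpace ℂ F] [CompleteSpace F]
    {f : ℕ → E} (hf : WeaklyNull f) (B : E →L[ℂ] F) :
    WeaklyNull (fun n => B (f n)) := fun v => by
  simpa [ContinuousLinearMap.adjoint_inner_left] using hf (B.adjoint v)

/-- The lower bound gives injectivity and a closed range; the range is dense because its orthogonal
complement is the kernel of the adjoint, which is `T` itself. -/
lemma isUnit_of_bounded_below {T : E →L[ℂ] E} (hT : IsSelfAdjoint T) {c : ℝ} (hc : 0 < c)
    (h : ∀ f, c * ‖f‖ ≤ ‖T f‖) : IsUnit T := by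
  rw [ContinuousLinearMap.isUnit_iff_bijective,
    ContinuousLinearMap.bijective_iff_dense_range_and_antilipschitz]
  have hker : T.ker = ⊥ := by
    rw [LinearMap.ker_eq_bot']
    intro f hf
    have := h f
    rw [ContinuousLinearMap.coe_coe] at hf
    rw [hf, norm_zero] at this
    exact norm_le_zero_iff.1 (by nlinarith [norm_nonneg f])
  refine ⟨?_, c⁻¹.toNNReal, ?_⟩
  · rw [Submodule.topologicalClosure_eq_top_iff, T.orthogonal_range, hT.adjoint_eq, hker]
  · refine ContinuousLinearMap.antilipschitz_of_bound _ fun f => ?_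
    rw [Real.coe_toNNReal _ (by positivity), ← div_eq_inv_mul, le_div_iff₀ hc, mul_comm]
    exact h f

lemma isSelfAdjoint_sub_real {A : E →L[ℂ] E} (hA : IsSelfAdjoint A) (t : ℝ) :
    IsSelfAdjoint (A - algebraMap ℂ (E →L[ℂ] E) t) := by
  refine hA.sub (IsSelfAdjoint.algebraMap _ ?_)
  exact Complex.conj_ofReal t

omit [CompleteSpace E] in
lemma sub_algebraMap_apply (A : E →L[ℂ] E) (z : ℂ) (f : E) :
    (A - algebraMap ℂ (E →L[ℂ] E) z) f = A f - z • f := by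
  simp [Algebra.algebraMap_eq_smul_one]

lemma notMem_spectrum_of_bounded_below {A : E →L[ℂ] E} (hA : IsSelfAdjoint A) (t : ℝ) {c : ℝ}
    (hc : 0 < c) (h : ∀ f, c * ‖f‖ ≤ ‖A f - (t : ℂ) • f‖) : (t : ℂ) ∉ spectrum ℂ A := by
  rw [spectrum.notMem_iff, IsUnit.sub_iff]
  exact isUnit_of_bounded_below (isSelfAdjoint_sub_real hA t) hc fun f => by
    rw [sub_algebraMap_apply]; exact h f

/-- Sufficiency in Weyl's criterion for the essential spectrum. -/
theorem mem_essentialSpectrum_of_weaklyNull {A : E →L[ℂ] E} (hA : IsSelfAdjoint A) {z : ℂ}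
    (h : ∀ ε > 0, ∃ f : ℕ → E, ∃ r > 0, (∀ n, ‖f n‖ = r) ∧ WeaklyNull f ∧
      ∀ᶠ n in atTop, ‖A (f n) - z • f n‖ ≤ ε * r) : z ∈ essentialSpectrum A := by
  -- Off the essential spectrum `A - z` has a left inverse `B` modulo an operator `Q` with range in
  -- a finite-dimensional space. A weakly null sequence is sent by `Q` to a norm null one, so it
  -- cannot be almost annihilated by `A - z`.
  suffices H : z ∉ essentialSpectrum A → ∃ B Q : E →L[ℂ] E,
      (∃ N : Submodule ℂ E, FiniteDimensional ℂ N ∧ ∀ f, Q f ∈ N) ∧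
        ∀ f, f = B (A f - z • f) + Q f by
    by_contra hz
    obtain ⟨B, Q, ⟨N, hN, hQ⟩, hBQ⟩ := H hz
    -- This tolerance bounds the `B` term by `r / 4`, while the `Q` term is eventually below `r /
    -- 2`; their sum cannot reach `r`.
    obtain ⟨f, r, hr, hfr, hf, hfA⟩ := h (1 / (4 * (‖B‖ + 1))) (by positivity)
    have hQf := ((hf.map Q).tendsto_of_finiteDimensional N fun n => hQ _).norm
    rw [norm_zero] at hQf
    have hQf' := hQf.eventually_lt_const (show (0 : ℝ) < r / 2 by positivity)
    obtain ⟨n, hn1, hn2⟩ := (hfA.and hQf').exists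
    have h1 : r ≤ ‖B‖ * ‖A (f n) - z • f n‖ + ‖Q (f n)‖ := by
      rw [← hfr n]
      conv_lhs => rw [hBQ (f n)]
      exact (norm_add_le _ _).trans (add_le_add_left (B.le_opNorm _) _)
    have h2 : ‖B‖ * ‖A (f n) - z • f n‖ ≤ ‖B‖ * (1 / (4 * (‖B‖ + 1)) * r) :=
      mul_le_mul_of_nonneg_left hn1 (norm_nonneg _)
    have h3 : ‖B‖ * (1 / (4 * (‖B‖ + 1)) * r) ≤ r / 4 := by
      have : 0 ≤ ‖B‖ := norm_nonneg _
      rw [show ‖B‖ * (1 / (4 * (‖B‖ + 1)) * r) = (r / 4) * (‖B‖ / (‖B‖ + 1)) by field_simp]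
      exact mul_le_of_le_one_right (by positivity) ((div_le_one (by positivity)).2 (by linarith))
    linarith
  intro hz
  by_cases hs : z ∈ spectrum ℂ A
  · have hd : z ∈ discreteSpectrum A := by
      by_contra hd; exact hz ⟨hs, hd⟩
    obtain ⟨⟨r, hr, hiso⟩, -, hfin⟩ := hd
    have hn : IsStarNormal A := hA.isStarNormal
    -- As `z` is isolated in the spectrum, continuity away from `z` is all that the functional
    -- calculus requires.
    have hopen : ∀ g : ℂ → ℂ, ContinuousOn g {z}ᶜ → ContinuousOn g (spectrum ℂ A) := by
      intro g hg w hw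
      by_cases hwz : w = z
      · subst hwz
        have : 𝓝[spectrum ℂ A] w = pure w := by
          rw [← nhdsWithin_singleton, ← hiso, Set.inter_comm]
          exact (nhdsWithin_inter_of_mem
            (mem_nhdsWithin_of_mem_nhds (Metric.ball_mem_nhds w hr))).symm
        rw [ContinuousWithinAt, this]
        exact tendsto_pure_nhds _ _
      · exact ((hg w hwz).continuousAt (isOpen_compl_singleton.mem_nhds hwz)).continuousWithinAt
    -- `χ` gives the Riesz projection onto the eigenspace and `g` the reduced resolvent, with `g z =
    -- 0` by the convention for inverses; thus `g w * (w - z) + χ w = 1` everywhere.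
    let g : ℂ → ℂ := fun w => (w - z)⁻¹
    let χ : ℂ → ℂ := fun w => if w = z then 1 else 0
    have hg : ContinuousOn g (spectrum ℂ A) := hopen g
      (ContinuousOn.inv₀ (by fun_prop) fun w hw => sub_ne_zero.2 hw)
    have hχ : ContinuousOn χ (spectrum ℂ A) := hopen χ
      (continuousOn_const.congr fun w hw => if_neg hw)
    have hsub : cfc (fun w : ℂ => w - z) A = A - algebraMap ℂ _ z := by
      rw [cfc_sub _ _ A, cfc_id' ℂ A, cfc_const z A]
    have hker : (A - algebraMap ℂ _ z) * cfc χ A = 0 := by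
      rw [← hsub, ← cfc_mul _ _ A]
      have : (fun w => (w - z) * χ w) = fun _ => 0 := by
        funext w; by_cases hw : w = z <;> simp [χ, hw]
      rw [this, cfc_const_zero]
    have hone : cfc g A * (A - algebraMap ℂ _ z) + cfc χ A = 1 := by
      rw [← hsub, ← cfc_mul _ _ A, ← cfc_add A (fun w => g w * (w - z)) χ (hg.mul (by fun_prop)) hχ]
      have : (fun w => g w * (w - z) + χ w) = fun _ => 1 := by
        funext w
        by_cases hw : w = z
        · simp [χ, hw]
        · simp [χ, g, hw, sub_ne_zero.2 hw]
      rw [this, cfc_const_one ℂ A]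
    refine ⟨cfc g A, cfc χ A, ⟨_, hfin, fun f => ?_⟩, fun f => ?_⟩
    · rw [Module.End.mem_eigenspace_iff]
      have := congrArg (fun T : E →L[ℂ] E => T f) hker
      simpa [Algebra.algebraMap_eq_smul_one, sub_eq_zero] using this
    · have := congrArg (fun T : E →L[ℂ] E => T f) hone
      simpa [Algebra.algebraMap_eq_smul_one] using this.symm
  · rw [spectrum.notMem_iff, IsUnit.sub_iff] at hs
    obtain ⟨u, hu⟩ := hs
    refine ⟨(u⁻¹ : (E →L[ℂ] E)ˣ), 0, ⟨⊥, inferInstance, by simp⟩, fun f => ?_⟩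
    have := congrArg (fun T : E →L[ℂ] E => T f) u.inv_mul
    rw [hu] at this
    simpa [Algebra.algebraMap_eq_smul_one] using this.symm

/-- Necessity in Weyl's criterion for the essential spectrum. -/
theorem mem_discreteSpectrum_of_no_weaklyNull {A : E →L[ℂ] E} (hA : IsSelfAdjoint A) {t : ℝ}
    (ht : (t : ℂ) ∈ spectrum ℂ A)
    (h : ∀ f : ℕ → E, (∀ n, ‖f n‖ = 1) → WeaklyNull f →
      ¬ Tendsto (fun n => A (f n) - (t : ℂ) • f n) atTop (𝓝 0)) :
    (t : ℂ) ∈ discreteSpectrum A := by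
  set T : E →L[ℂ] E := A - algebraMap ℂ (E →L[ℂ] E) t with hTdef
  have hT : IsSelfAdjoint T := isSelfAdjoint_sub_real hA t
  have hTa : ∀ f, T f = A f - (t : ℂ) • f := sub_algebraMap_apply A t
  set N : Submodule ℂ E := T.ker with hNdef
  have hNe : N = Module.End.eigenspace (A : E →ₗ[ℂ] E) t := by
    ext f
    rw [Module.End.mem_eigenspace_iff, hNdef, LinearMap.mem_ker, ContinuousLinearMap.coe_coe, hTa,
      sub_eq_zero, ContinuousLinearMap.coe_coe]
  have hNc : IsClosed (N : Set E) := T.isClosed_ker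
  have : CompleteSpace N := hNc.completeSpace_coe
  -- An infinite orthonormal family in the kernel would be a forbidden sequence.
  have hfin : FiniteDimensional ℂ N := by
    obtain ⟨w, b, hb⟩ := exists_hilbertBasis ℂ N
    by_cases hw : w.Finite
    · have : Fintype w := hw.fintype
      exact Module.Finite.of_basis b.toOrthonormalBasis.toBasis
    · exfalso
      have := Set.Infinite.to_subtype hw
      let e := Infinite.natEmbedding w
      have ho : Orthonormal ℂ (fun n => (b (e n) : E)) :=
        (b.orthonormal.comp e e.injective).comp_linearIsometry N.subtypeₗᵢ
      refine h _ ho.1 ho.weaklyNull ?_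
      have hz : ∀ n, A (b (e n)) - (t : ℂ) • (b (e n) : E) = 0 := fun n => by
        rw [← hTa]; exact (b (e n)).2
      simp only [hz]
      exact tendsto_const_nhds
  -- Otherwise there are unit vectors `g n` in `Nᗮ` with `T (g n) → 0`. They are weakly null: they
  -- are orthogonal to `N`, and `Nᗮ` is the closure of the range of `T`, where `⟪T u, g n⟫ = ⟪u, T
  -- (g n)⟫ → 0`.
  have hbelow : ∃ c > 0, ∀ f ∈ Nᗮ, c * ‖f‖ ≤ ‖T f‖ := by
    by_contra! hcon
    choose f hfN hf using fun n : ℕ => hcon (1 / (n + 1 : ℝ)) (by positivity)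
    have hf0 : ∀ n, f n ≠ 0 := fun n h0 => by
      have := hf n; simp [h0] at this
    let g : ℕ → E := fun n => ((‖f n‖⁻¹ : ℝ) : ℂ) • f n
    have hg1 : ∀ n, ‖g n‖ = 1 := fun n => by
      simp only [g, norm_smul, Complex.norm_real, norm_inv, norm_norm]
      exact inv_mul_cancel₀ (norm_ne_zero_iff.2 (hf0 n))
    have hTg : Tendsto (fun n => T (g n)) atTop (𝓝 0) := by
      refine squeeze_zero_norm (fun n => ?_) tendsto_one_div_add_atTop_nhds_zero_nat
      simp only [g, map_smul, norm_smul, Complex.norm_real, norm_inv, norm_norm]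
      rw [inv_mul_le_iff₀ (norm_pos_iff.2 (hf0 n)), mul_comm]
      exact (hf n).le
    refine h g hg1 (fun v => ?_) (by simpa only [← hTa] using hTg)
    have hgN : ∀ n, g n ∈ Nᗮ := fun n => Nᗮ.smul_mem _ (hfN n)
    have hdense : Nᗮ = T.range.topologicalClosure := by
      rw [hNdef, T.orthogonal_ker, hT.adjoint_eq]
    rw [Metric.tendsto_atTop]
    intro ε hε
    obtain ⟨y, hy, z, hz, rfl⟩ := N.exists_add_mem_mem_orthogonal v
    rw [hdense, ← SetLike.mem_coe, Submodule.topologicalClosure_coe] at hz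
    obtain ⟨_, ⟨u, rfl⟩, hu⟩ := Metric.mem_closure_iff.1 hz (ε / 2) (by positivity)
    have hlim : Tendsto (fun n => ⟪u, T (g n)⟫_ℂ) atTop (𝓝 0) := by
      simpa using (tendsto_const_nhds (x := u)).inner (𝕜 := ℂ) hTg
    obtain ⟨n₀, hn₀⟩ := Metric.tendsto_atTop.1 hlim (ε / 2) (by positivity)
    refine ⟨n₀, fun n hn => ?_⟩
    have h1 := hn₀ n hn
    rw [dist_zero_right] at h1 ⊢
    have hsym : ⟪T u, g n⟫_ℂ = ⟪u, T (g n)⟫_ℂ := by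
      conv_rhs => rw [← ContinuousLinearMap.adjoint_inner_left, hT.adjoint_eq]
    have e : ⟪y + z, g n⟫_ℂ = ⟪z - T u, g n⟫_ℂ + ⟪u, T (g n)⟫_ℂ := by
      rw [inner_add_left, hgN n y hy, inner_sub_left, hsym]; ring
    rw [e]
    rw [ContinuousLinearMap.coe_coe, dist_eq_norm] at hu
    calc _ ≤ ‖⟪z - T u, g n⟫_ℂ‖ + ‖⟪u, T (g n)⟫_ℂ‖ := norm_add_le _ _
      _ ≤ ‖z - T u‖ * ‖g n‖ + ‖⟪u, T (g n)⟫_ℂ‖ := by gcongr; exact norm_inner_le_norm _ _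
      _ < ε := by rw [hg1]; linarith
  obtain ⟨c, hc, hcb⟩ := hbelow
  -- `A - s` preserves `N` and `Nᗮ`: on `N` it is the scalar `t - s`, on `Nᗮ` it is bounded below by
  -- `c - |s - t|`. Pythagoras combines the two bounds.
  have hsplit : ∀ s : ℝ, |s - t| < c → ∀ f,
      (min |s - t| (c - |s - t|)) * ‖f‖ ≤ ‖A f - (s : ℂ) • f‖ := by
    intro s hs f
    obtain ⟨y, hy, z, hz, rfl⟩ := N.exists_add_mem_mem_orthogonal f
    set δ := min |s - t| (c - |s - t|)
    have hδ : 0 ≤ δ := le_min (abs_nonneg _) (by linarith)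
    have hTy : T y = 0 := hy
    have hTz : T z ∈ Nᗮ := by
      rw [hNdef, T.orthogonal_ker, hT.adjoint_eq]
      exact Submodule.le_topologicalClosure _ ⟨z, rfl⟩
    have e : A (y + z) - (s : ℂ) • (y + z) = ((t - s : ℝ) : ℂ) • y + (T z + ((t - s : ℝ) : ℂ) • z) := by
      have h1 : A y = (t : ℂ) • y := by rw [hTa, sub_eq_zero] at hTy; exact hTy
      rw [hTa, map_add, h1]; push_cast; module
    have ho : ⟪((t - s : ℝ) : ℂ) • y, T z + ((t - s : ℝ) : ℂ) • z⟫_ℂ = 0 :=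
      (Nᗮ.add_mem hTz (Nᗮ.smul_mem _ hz)) _ (N.smul_mem _ hy)
    have ho' : ⟪y, z⟫_ℂ = 0 := hz y hy
    have p1 := norm_add_sq_eq_norm_sq_add_norm_sq_of_inner_eq_zero _ _ ho
    have p2 := norm_add_sq_eq_norm_sq_add_norm_sq_of_inner_eq_zero _ _ ho'
    have n1 : δ * ‖y‖ ≤ ‖((t - s : ℝ) : ℂ) • y‖ := by
      rw [norm_smul, Complex.norm_real, Real.norm_eq_abs, abs_sub_comm]
      exact mul_le_mul_of_nonneg_right (min_le_left _ _) (norm_nonneg _)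
    have n2 : δ * ‖z‖ ≤ ‖T z + ((t - s : ℝ) : ℂ) • z‖ := by
      have a1 := hcb z hz
      have a2 : ‖T z‖ - ‖((t - s : ℝ) : ℂ) • z‖ ≤ ‖T z + ((t - s : ℝ) : ℂ) • z‖ := by
        simpa using norm_sub_norm_le (T z) (-(((t - s : ℝ) : ℂ) • z))
      rw [norm_smul, Complex.norm_real, Real.norm_eq_abs, abs_sub_comm] at a2
      have a3 : δ * ‖z‖ ≤ (c - |s - t|) * ‖z‖ :=
        mul_le_mul_of_nonneg_right (min_le_right _ _) (norm_nonneg _)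
      linarith
    rw [e]
    refine abs_le_of_sq_le_sq' ?_ (norm_nonneg _) |>.2
    have q1 := mul_self_le_mul_self (by positivity) n1
    have q2 := mul_self_le_mul_self (by positivity) n2
    rw [mul_pow, sq ‖y + z‖, p2, sq ‖_ + _‖, p1]
    linarith
  refine ⟨⟨c, hc, ?_⟩, ?_, hNe ▸ hfin⟩
  · refine Set.Subset.antisymm ?_ (by simpa using ⟨ht, hc⟩)
    rintro w ⟨hw, hwb⟩
    have hwr := hA.mem_spectrum_eq_re hw
    rw [hwr, Metric.mem_ball, dist_eq_norm, ← Complex.ofReal_sub, Complex.norm_real,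
      Real.norm_eq_abs] at hwb
    by_contra hne
    have hne' : w.re ≠ t := fun h0 => hne (by rw [hwr, h0]; rfl)
    rw [hwr] at hw
    exact notMem_spectrum_of_bounded_below hA w.re
      (lt_min (abs_pos.2 (sub_ne_zero.2 hne')) (by linarith)) (hsplit w.re hwb) hw
  · rw [Module.End.hasEigenvalue_iff, ← hNe]
    intro hN
    refine notMem_spectrum_of_bounded_below hA t hc (fun f => ?_) ht
    rw [← hTa]
    exact hcb f (by rw [hN, Submodule.bot_orthogonal_eq_top]; trivial)

end Weyl

/-! ### Multiplication, averaging and modulation on `L₂`. -/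

section L2

variable {X Y : Type*} [MeasurableSpace X] [MeasurableSpace Y] {ν : Measure X} {ρ : Measure Y}

lemma L2_inner_eq (f g : Lp ℂ 2 ν) : ⟪f, g⟫_ℂ = ∫ x, (starRingEnd ℂ) (f x) * g x ∂ν := by
  rw [L2.inner_def]
  exact integral_congr_ae (Eventually.of_forall fun x => by simp [mul_comm])

lemma L2_norm_sq (f : Lp ℂ 2 ν) : ‖f‖ ^ 2 = ∫ x, ‖f x‖ ^ 2 ∂ν := by
  have h := L2_inner_eq f f
  rw [inner_self_eq_norm_sq_to_K] at h
  have h2 : (∫ x, (starRingEnd ℂ) (f x) * f x ∂ν) = ((∫ x, ‖f x‖ ^ 2 ∂ν : ℝ) : ℂ) := by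
    rw [← integral_complex_ofReal]
    refine integral_congr_ae (Eventually.of_forall fun x => ?_)
    simp only [Complex.conj_mul']
    push_cast; rfl
  rw [h2] at h
  refine Complex.ofReal_injective (Eq.trans ?_ h)
  push_cast; rfl

lemma integrable_norm_sq (f : Lp ℂ 2 ν) : Integrable (fun x => ‖f x‖ ^ 2) ν := by
  have := (Lp.memLp f).integrable_norm_rpow (by norm_num) (by norm_num)
  simpa using this

lemma integrable_conj_mul (f g : Lp ℂ 2 ν) :
    Integrable (fun x => (starRingEnd ℂ) (f x) * g x) ν :=
  (L2.integrable_inner (𝕜 := ℂ) f g).congr (Eventually.of_forall fun x => by simp [mul_comm])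

/-- Dominated convergence in `L₂`. -/
lemma tendsto_zero_of_dominated (f : ℕ → Lp ℂ 2 ν) (D : Lp ℂ 2 ν)
    (hD : ∀ n, ∀ᵐ x ∂ν, ‖f n x‖ ≤ ‖D x‖)
    (hlim : ∀ᵐ x ∂ν, Tendsto (fun n => f n x) atTop (𝓝 0)) : Tendsto f atTop (𝓝 0) := by
  rw [tendsto_zero_iff_norm_tendsto_zero]
  have h : Tendsto (fun n => ∫ x, ‖f n x‖ ^ 2 ∂ν) atTop (𝓝 (∫ _, 0 ∂ν)) := by
    refine tendsto_integral_of_dominated_convergence (fun x => ‖D x‖ ^ 2)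
      (fun n => (Lp.aestronglyMeasurable (f n)).norm.pow 2) (integrable_norm_sq D) (fun n => ?_) ?_
    · filter_upwards [hD n] with x hx
      rw [norm_pow, norm_norm]
      exact pow_le_pow_left₀ (norm_nonneg _) hx 2
    · filter_upwards [hlim] with x hx
      simpa using hx.norm.pow 2
  rw [integral_zero] at h
  have := h.sqrt
  rw [Real.sqrt_zero] at this
  refine this.congr fun n => ?_
  rw [← L2_norm_sq, Real.sqrt_sq (norm_nonneg _)]

lemma L2_norm_le_of_ae_le {f g : Lp ℂ 2 ν} {C : ℝ} (h : ∀ᵐ x ∂ν, ‖f x‖ ≤ C * ‖g x‖) :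
    ‖f‖ ≤ C * ‖g‖ := Lp.norm_le_mul_norm_of_ae_le_mul h

lemma isSelfAdjoint_of_symm {E : Type*} [NormedAddCommGroup E] [InnerProductSpace ℂ E]
    [CompleteSpace E] {A : E →L[ℂ] E} (h : ∀ f g, ⟪A f, g⟫_ℂ = ⟪f, A g⟫_ℂ) : IsSelfAdjoint A :=
  ContinuousLinearMap.isSelfAdjoint_iff_isSymmetric.2 h

lemma isSelfAdjoint_mulOp (g : X → ℝ) (hg : Measurable g) (hb : ∃ C, ∀ x, |g x| ≤ C) :
    IsSelfAdjoint (mulOp (ν := ν) g hg hb) := by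
  refine isSelfAdjoint_of_symm fun f₁ f₂ => ?_
  rw [L2_inner_eq, L2_inner_eq]
  refine integral_congr_ae ?_
  filter_upwards [mulOp_apply g hg hb f₁, mulOp_apply g hg hb f₂] with x h₁ h₂
  rw [h₁, h₂, map_mul, Complex.conj_ofReal]; ring

/-- Fubini writes the form of the averaging operator in terms of the slice integrals of both
functions, and its symmetry becomes visible. -/
lemma inner_avgFst [IsFiniteMeasure ν] [IsFiniteMeasure ρ] (f g : Lp ℂ 2 (ν.prod ρ)) :
    ⟪avgFst f, g⟫_ℂ =
      ∫ p, (starRingEnd ℂ) (∫ q, f (q, p) ∂ν) * (∫ q, g (q, p) ∂ν) ∂ρ := by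
  have hae : (fun x => (starRingEnd ℂ) (avgFst f x) * g x) =ᵐ[ν.prod ρ]
      fun x => (starRingEnd ℂ) (∫ q, f (q, x.2) ∂ν) * g x := by
    filter_upwards [avgFst_apply f] with x hx
    rw [hx]
  rw [L2_inner_eq, integral_congr_ae hae,
    integral_prod_symm _ ((integrable_conj_mul (avgFst f) g).congr hae)]
  simp only [integral_const_mul]

lemma isSelfAdjoint_avgFst [IsFiniteMeasure ν] [IsFiniteMeasure ρ] :
    IsSelfAdjoint (avgFst (ν := ν) (ρ := ρ)) := by
  refine isSelfAdjoint_of_symm fun f g => ?_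
  rw [inner_avgFst, ← inner_conj_symm, inner_avgFst, ← integral_conj]
  refine integral_congr_ae (Eventually.of_forall fun p => ?_)
  simp [mul_comm]

lemma inner_avg [IsFiniteMeasure ν] (f g : Lp ℂ 2 ν) :
    ⟪avg f, g⟫_ℂ = (starRingEnd ℂ) (∫ q, f q ∂ν) * ∫ q, g q ∂ν := by
  rw [L2_inner_eq, ← integral_const_mul]
  refine integral_congr_ae ?_
  filter_upwards [avg_apply f] with x hx
  rw [hx]

lemma isSelfAdjoint_avg [IsFiniteMeasure ν] : IsSelfAdjoint (avg (ν := ν)) := by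
  refine isSelfAdjoint_of_symm fun f g => ?_
  rw [inner_avg, ← inner_conj_symm, inner_avg, map_mul, Complex.conj_conj, mul_comm]

/-- Multiplication of an element of `L₂` by a measurable function with values of modulus one. -/
def twist (χ : X → ℂ) (hχ : Measurable χ) (h1 : ∀ x, ‖χ x‖ = 1) (f : Lp ℂ 2 ν) : Lp ℂ 2 ν :=
  MemLp.toLp (fun x => χ x * f x) ((Lp.memLp f).of_le
    (hχ.aestronglyMeasurable.mul (Lp.aestronglyMeasurable f))
    (Eventually.of_forall fun x => by rw [norm_mul, h1, one_mul]))

lemma twist_apply (χ : X → ℂ) (hχ : Measurable χ) (h1 : ∀ x, ‖χ x‖ = 1) (f : Lp ℂ 2 ν) :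
    twist χ hχ h1 f =ᵐ[ν] fun x => χ x * f x := MemLp.coeFn_toLp _

lemma norm_twist (χ : X → ℂ) (hχ : Measurable χ) (h1 : ∀ x, ‖χ x‖ = 1) (f : Lp ℂ 2 ν) :
    ‖twist χ hχ h1 f‖ = ‖f‖ := by
  rw [twist, Lp.norm_toLp, Lp.norm_def]
  congr 1
  exact eLpNorm_congr_norm_ae (Eventually.of_forall fun x => by rw [norm_mul, h1, one_mul])

/-- Supplies the dominating function for twisted averages: a factor of modulus one does not change
the slice average of `‖G‖`. -/
lemma norm_avgFst_apply_le [IsFiniteMeasure ν] [IsFiniteMeasure ρ] (G : Lp ℂ 2 (ν.prod ρ)) :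
    ∃ D : Lp ℂ 2 (ν.prod ρ), ∀ᵐ x ∂(ν.prod ρ), ‖D x‖ = ∫ q, ‖G (q, x.2)‖ ∂ν := by
  have hG : MemLp (fun x => ((‖G x‖ : ℝ) : ℂ)) 2 (ν.prod ρ) :=
    (Lp.memLp G).of_le (Complex.continuous_ofReal.comp_aestronglyMeasurable
      (Lp.aestronglyMeasurable G).norm) (Eventually.of_forall fun x => by simp)
  refine ⟨avgFst (hG.toLp _), ?_⟩
  filter_upwards [avgFst_apply (hG.toLp _), ae_slice hG.coeFn_toLp] with x hx hx2
  rw [hx, integral_congr_ae hx2, integral_complex_ofReal, Complex.norm_real, Real.norm_eq_abs,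
    abs_of_nonneg (integral_nonneg fun _ => norm_nonneg _)]

/-- If the averages over the slices tend to zero, the twisted functions are asymptotically in the
kernel of the averaging operator. -/
lemma tendsto_avgFst_twist [IsFiniteMeasure ν] [IsFiniteMeasure ρ] (G : Lp ℂ 2 (ν.prod ρ))
    (χ : ℕ → X × Y → ℂ) (hχ : ∀ n, Measurable (χ n)) (h1 : ∀ n x, ‖χ n x‖ = 1)
    (hlim : ∀ p, Tendsto (fun n => ∫ q, χ n (q, p) * G (q, p) ∂ν) atTop (𝓝 0)) :
    Tendsto (fun n => avgFst (twist (χ n) (hχ n) (h1 n) G)) atTop (𝓝 0) := by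
  obtain ⟨D, hD⟩ := norm_avgFst_apply_le G
  have key : ∀ n, ∀ᵐ x ∂(ν.prod ρ), avgFst (twist (χ n) (hχ n) (h1 n) G) x =
      ∫ q, χ n (q, x.2) * G (q, x.2) ∂ν := fun n => by
    filter_upwards [avgFst_apply (twist (χ n) (hχ n) (h1 n) G),
      ae_slice (twist_apply (χ n) (hχ n) (h1 n) G)] with x hx hx2
    rw [hx, integral_congr_ae hx2]
  refine tendsto_zero_of_dominated _ D (fun n => ?_) ?_
  · filter_upwards [key n, hD] with x hx hx2
    rw [hx, hx2]
    refine (norm_integral_le_integral_norm _).trans_eq ?_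
    simp [h1]
  · filter_upwards [ae_all_iff.2 key] with x hx
    simpa only [hx] using hlim x.2

/-- For `f` weakly null, `∫ g(q, p) (∫ f(s, θ(q, p)) ds) dq` tends to zero in the `L₂` sense. -/
lemma tendsto_avgFst_mulOp_comp [IsFiniteMeasure ν] (g : X × X → ℝ) (hg : Measurable g)
    (hb : ∃ C, ∀ x, |g x| ≤ C) (Θ : X × X → X × X)
    (hΘ : MeasurePreserving Θ (ν.prod ν) (ν.prod ν))
    (hΘs : ∀ p, MeasurePreserving (fun q => (Θ (q, p)).2) ν ν)
    (f : ℕ → Lp ℂ 2 (ν.prod ν)) {M : ℝ} (hM : ∀ n, ‖f n‖ ≤ M) (hf : WeaklyNull f) :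
    Tendsto (fun n => avgFst (mulOp g hg hb
      (Lp.compMeasurePreservingₗᵢ ℂ Θ hΘ (avgFst (f n))))) atTop (𝓝 0) := by
  have hgp : ∀ p, MemLp (fun x : X × X => (g (x.1, p) : ℂ)) 2 (ν.prod ν) := fun p =>
    MemLp.of_bound (Complex.measurable_ofReal.comp
      (hg.comp (measurable_fst.prodMk measurable_const))).aestronglyMeasurable hb.choose
      (Eventually.of_forall fun x => by
        rw [Complex.norm_real]; exact hb.choose_spec _)
  -- For fixed `p` the map `(q, s) ↦ (s, θ(q, p))` preserves the measure, so the double integral is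
  -- the inner product of the fixed function `g(·, p)` with an isometric image of `f n`. Weak
  -- nullity then gives convergence for each `p`, and Cauchy-Schwarz a constant dominating function.
  let W : ∀ p, Lp ℂ 2 (ν.prod ν) →L[ℂ] Lp ℂ 2 (ν.prod ν) := fun p =>
    (Lp.compMeasurePreservingₗᵢ ℂ (fun x : X × X => (x.2, (Θ (x.1, p)).2))
      (Measure.measurePreserving_swap.comp
        ((hΘs p).prod (MeasurePreserving.id ν)))).toContinuousLinearMap
  have key : ∀ n, ∀ᵐ x ∂(ν.prod ν), avgFst (mulOp g hg hb
      (Lp.compMeasurePreservingₗᵢ ℂ Θ hΘ (avgFst (f n)))) x =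
      ⟪(hgp x.2).toLp _, W x.2 (f n)⟫_ℂ := fun n => by
    have e1 := hΘ.quasiMeasurePreserving.ae (avgFst_apply (f n))
    have e2 : (Lp.compMeasurePreservingₗᵢ ℂ Θ hΘ (avgFst (f n)) : X × X → ℂ) =ᵐ[ν.prod ν]
        avgFst (f n) ∘ Θ := Lp.coeFn_compMeasurePreserving _ hΘ
    filter_upwards [avgFst_apply (mulOp g hg hb (Lp.compMeasurePreservingₗᵢ ℂ Θ hΘ (avgFst (f n)))),
      ae_slice (mulOp_apply g hg hb (Lp.compMeasurePreservingₗᵢ ℂ Θ hΘ (avgFst (f n)))),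
      ae_slice e1, ae_slice e2] with x hx h1 h2 h3
    have hW : (W x.2 (f n) : X × X → ℂ) =ᵐ[ν.prod ν] fun y => f n (y.2, (Θ (y.1, x.2)).2) :=
      Lp.coeFn_compMeasurePreserving _ _
    have hae : (fun y => (starRingEnd ℂ) ((hgp x.2).toLp _ y) * W x.2 (f n) y) =ᵐ[ν.prod ν]
        fun y => (g (y.1, x.2) : ℂ) * f n (y.2, (Θ (y.1, x.2)).2) := by
      filter_upwards [hW, (hgp x.2).coeFn_toLp] with y hy1 hy2
      rw [hy1, hy2, Complex.conj_ofReal]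
    rw [hx, L2_inner_eq, integral_congr_ae hae,
      integral_prod _ ((integrable_conj_mul _ _).congr hae)]
    refine integral_congr_ae ?_
    filter_upwards [h1, h2, h3] with q k1 k2 k3
    rw [k1, k3, Function.comp_apply, k2, integral_const_mul]
  obtain ⟨C, hC⟩ := hb
  have hnn : 0 ≤ M := (norm_nonneg _).trans (hM 0)
  have hgn : ∀ p, ‖(hgp p).toLp _‖ ≤ ‖Lp.const 2 (ν.prod ν) (C : ℂ)‖ := fun p => by
    have hle : ∀ᵐ x ∂(ν.prod ν), ‖(hgp p).toLp _ x‖ ≤ 1 * ‖Lp.const 2 (ν.prod ν) (C : ℂ) x‖ := by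
      filter_upwards [(hgp p).coeFn_toLp, Lp.coeFn_const (p := 2) (μ := ν.prod ν) (C : ℂ)]
        with x h1 h2
      rw [h1, h2, one_mul, Function.const_apply, Complex.norm_real, Complex.norm_real]
      exact (hC _).trans (le_abs_self C)
    simpa using L2_norm_le_of_ae_le hle
  set B : ℝ := ‖Lp.const 2 (ν.prod ν) (C : ℂ)‖
  refine tendsto_zero_of_dominated _ (Lp.const 2 (ν.prod ν) ((B * M : ℝ) : ℂ)) (fun n => ?_) ?_
  · filter_upwards [key n, Lp.coeFn_const (p := 2) (μ := ν.prod ν) ((B * M : ℝ) : ℂ)] with x hx h2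
    rw [hx, h2, Function.const_apply, Complex.norm_real, Real.norm_eq_abs,
      abs_of_nonneg (mul_nonneg (norm_nonneg _) hnn)]
    refine (norm_inner_le_norm _ _).trans (mul_le_mul (hgn _) ?_ (norm_nonneg _) (norm_nonneg _))
    exact ((Lp.compMeasurePreservingₗᵢ ℂ _ _).norm_map (f n)).trans_le (hM n)
  · filter_upwards [ae_all_iff.2 key] with x hx
    simp only [hx]
    exact hf.map (W x.2) _

end L2

/-! ### Oscillatory integrals. -/

section RiemannLebesgue

/-- The Riemann-Lebesgue lemma along the multiples of a nonzero linear form. -/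
lemma tendsto_integral_exp_mul {V : Type*} [NormedAddCommGroup V] [NormedSpace ℝ V]
    [FiniteDimensional ℝ V] [MeasurableSpace V] [BorelSpace V] (μ : Measure V)
    [μ.IsAddHaarMeasure] (L : V →L[ℝ] ℝ) (hL : L ≠ 0) (c : ℝ) (s : Set V) (hs : MeasurableSet s)
    (f : V → ℂ) :
    Tendsto (fun n : ℕ => ∫ v in s, Complex.exp ((n * (c + L v) : ℝ) * Complex.I) * f v ∂μ)
      atTop (𝓝 0) := by
  -- The Fourier character is `exp (2πi ·)`, evaluated at minus the frequency; this explains the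
  -- factor `-1 / (2π)`.
  have h1 : Tendsto (fun n : ℕ => (-(n / (2 * π)) : ℝ) • L) atTop
      (cocompact (StrongDual ℝ V)) := by
    rw [← Metric.cobounded_eq_cocompact, ← tendsto_norm_atTop_iff_cobounded]
    simp only [norm_smul, norm_neg, norm_div, Real.norm_natCast]
    refine Tendsto.atTop_mul_const (norm_pos_iff.2 hL) ?_
    exact tendsto_natCast_atTop_atTop.atTop_div_const (by simp [Real.pi_ne_zero])
  have h2 := (tendsto_integral_exp_smul_cocompact (s.indicator f) μ).comp h1
  rw [tendsto_zero_iff_norm_tendsto_zero] at h2 ⊢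
  refine h2.congr fun n => ?_
  have h3 : ∀ v, Complex.exp ((n * (c + L v) : ℝ) * Complex.I) * f v =
      Complex.exp ((n * c : ℝ) * Complex.I) * (Complex.exp ((n * L v : ℝ) * Complex.I) * f v) := by
    intro v
    rw [← mul_assoc, ← Complex.exp_add]
    congr 2; push_cast; ring
  simp only [h3, integral_const_mul, norm_mul, Complex.norm_exp_ofReal_mul_I, one_mul]
  rw [← integral_indicator hs, Function.comp_apply]
  congr 2
  funext v
  by_cases hv : v ∈ s
  · simp only [hv, indicator_of_mem, Circle.smul_def, Real.fourierChar_apply, smul_eq_mul]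
    congr 3
    simp only [smul_apply, smul_eq_mul, neg_mul, neg_neg]
    field_simp
  · simp [hv]

end RiemannLebesgue

/-! ### Reduction modulo `2πℤ³` and positivity of the measure. -/

section Torus

lemma measurableSet_torus : MeasurableSet torus :=
  MeasurableSet.univ_pi fun _ => measurableSet_Ioc

lemma wrap_of_mem {x : Vec} (hx : x ∈ torus) : wrap x = x := by
  funext i
  rw [wrap, toIocMod_eq_self]
  have e : -π + 2 * π = π := by ring
  rw [e]; exact hx i trivial

lemma wrap_wrap (x : Vec) : wrap (wrap x) = wrap x := wrap_of_mem (wrap_mem x)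

lemma wrap_add_wrap (x y : Vec) : wrap (x + wrap y) = wrap (x + y) :=
  wrap_eq_wrap fun i => by
    obtain ⟨n, hn⟩ := wrap_spec y i
    exact ⟨n, by simp only [Pi.add_apply, hn]; ring⟩

lemma wrap_sub_wrap (x y : Vec) : wrap (x - wrap y) = wrap (x - y) :=
  wrap_eq_wrap fun i => by
    obtain ⟨n, hn⟩ := wrap_spec y i
    exact ⟨-n, by simp only [Pi.sub_apply, hn]; push_cast; ring⟩

lemma wrap_wrap_sub (x y : Vec) : wrap (wrap x - y) = wrap (x - y) :=
  wrap_eq_wrap fun i => by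
    obtain ⟨n, hn⟩ := wrap_spec x i
    exact ⟨n, by simp only [Pi.sub_apply, hn]; ring⟩

lemma dispersion_wrap (x : Vec) : dispersion (wrap x) = dispersion x := by
  unfold dispersion
  refine Finset.sum_congr rfl fun i _ => ?_
  obtain ⟨n, hn⟩ := wrap_spec x i
  rw [hn, Real.cos_add_int_mul_two_pi]

/-- A point of the half-open cube may lie on its boundary, but it is in the closure of the open
cube, which the open set `U` therefore meets. -/
lemma torusMeasure_pos {U : Set Vec} (hU : IsOpen U) {x : Vec} (hx : x ∈ torus) (hxU : x ∈ U) :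
    0 < torusMeasure U := by
  have hcl : x ∈ closure (Set.pi Set.univ fun _ : Fin 3 => Ioo (-π) π) := by
    rw [closure_pi_set]
    intro i _
    rw [closure_Ioo (by linarith [Real.pi_pos])]
    exact Ioc_subset_Icc_self (hx i trivial)
  have hne := mem_closure_iff.1 hcl U hU hxU
  have hop : IsOpen (U ∩ Set.pi Set.univ fun _ : Fin 3 => Ioo (-π) π) :=
    hU.inter (isOpen_set_pi finite_univ fun _ _ => isOpen_Ioo)
  rw [torusMeasure, Measure.restrict_apply hU.measurableSet]
  exact (hop.measure_pos volume hne).trans_le (measure_mono (inter_subset_inter_right _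
    (pi_mono fun _ _ => Ioo_subset_Ioc_self)))

lemma torusMeasure_prod_pos {U : Set (Vec × Vec)} (hU : IsOpen U) {x : Vec × Vec}
    (hx : x ∈ torus ×ˢ torus) (hxU : x ∈ U) : 0 < (torusMeasure.prod torusMeasure) U := by
  obtain ⟨u, v, hu, hv, hxu, hxv, huv⟩ := isOpen_prod_iff.1 hU x.1 x.2 hxU
  refine lt_of_lt_of_le ?_ (measure_mono huv)
  rw [Measure.prod_prod]
  exact ENNReal.mul_pos (torusMeasure_pos hu hx.1 hxu).ne' (torusMeasure_pos hv hx.2 hxv).ne'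

lemma ae_mem_torus_prod : ∀ᵐ x ∂(torusMeasure.prod torusMeasure), x ∈ torus ×ˢ torus := by
  rw [torusMeasure, Measure.prod_restrict]
  exact ae_restrict_mem (measurableSet_torus.prod measurableSet_torus)

end Torus

/-! ### Cyclic indices, coordinate changes and kinetic energy. -/

lemma fin3_cyc (a : Fin 3) : a + 1 ≠ a ∧ a + 2 ≠ a ∧ a + 2 ≠ a + 1 ∧ a + 1 + 1 = a + 2 ∧
    a + 1 + 2 = a ∧ a + 2 + 1 = a ∧ a + 2 + 2 = a + 1 := by
  revert a; decide

lemma fin3_cases (a i : Fin 3) : i = a ∨ i = a + 1 ∨ i = a + 2 := by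
  revert a i; decide

lemma sum_fin3 {M : Type*} [AddCommMonoid M] (f : Fin 3 → M) (a : Fin 3) :
    ∑ i, f i = f a + f (a + 1) + f (a + 2) := by
  rw [Fin.sum_univ_three]
  fin_cases a
  · rfl
  · change _ = f 1 + f 2 + f 0
    abel
  · change _ = f 2 + f 0 + f 1
    abel

namespace System

variable (S : System)

lemma eps_wrap (i : Fin 3) (x : Vec) : S.eps i (wrap x) = S.eps i x := by
  rw [eps, dispersion_wrap, eps]

lemma chart_zero (K : Vec) (a : Fin 3) (x : Vec × Vec) :
    S.chart K a x a = wrap (S.m a • K - x.2) := by simp [chart]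

lemma chart_one (K : Vec) (a : Fin 3) (x : Vec × Vec) : S.chart K a x (a + 1) =
    wrap (S.m (a + 1) • K + S.lfrac (a + 2) (a + 1) • x.2 + x.1) := by
  simp [chart]

lemma chart_two (K : Vec) (a : Fin 3) (x : Vec × Vec) : S.chart K a x (a + 2) =
    wrap (S.m (a + 2) • K + S.lfrac (a + 1) (a + 2) • x.2 - x.1) := by
  simp [chart, (fin3_cyc a).2.2.1]

lemma wrap_chart (K : Vec) (a i : Fin 3) (x : Vec × Vec) :
    wrap (S.chart K a x i) = S.chart K a x i := by
  rcases fin3_cases a i with rfl | rfl | rfl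
  · rw [chart_zero, wrap_wrap]
  · rw [chart_one, wrap_wrap]
  · rw [chart_two, wrap_wrap]

/-- The coordinates `(q_b, p_b)` determine `k_b` and `k_{b+1}`, and the total momentum fixes the
third. Hence any quantity defined through the particle momenta, such as the energy or the phases
below, is independent of the chart. -/
lemma chart_chartChange (K : Vec) (a b : Fin 3) (x : Vec × Vec) :
    S.chart K b (S.chartChange K a b x) = S.chart K a x := by
  have h0 : S.chart K b (S.chartChange K a b x) b = S.chart K a x b := by
    rw [chart_zero, chartChange, pCoord, wrap_sub_wrap, sub_sub_cancel, wrap_chart]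
  have h1 : S.chart K b (S.chartChange K a b x) (b + 1) = S.chart K a x (b + 1) := by
    rw [chart_one, chartChange, qCoord, wrap_add_wrap]
    convert S.wrap_chart K a (b + 1) x using 2
    abel
  funext i
  rcases fin3_cases b i with rfl | rfl | rfl
  · exact h0
  · exact h1
  · rw [chart_add_two, chart_add_two, h0, h1]

lemma chartChange_mem (K : Vec) (a b : Fin 3) (x : Vec × Vec) :
    S.chartChange K a b x ∈ torus ×ˢ torus := ⟨wrap_mem _, wrap_mem _⟩

lemma chartChange_chartChange (K : Vec) (a b c : Fin 3) (x : Vec × Vec) :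
    S.chartChange K b c (S.chartChange K a b x) = S.chartChange K a c x := by
  rw [chartChange, chart_chartChange, chartChange]

lemma chartChange_self (K : Vec) (a : Fin 3) {x : Vec × Vec} (hx : x ∈ torus ×ˢ torus) :
    S.chartChange K a a x = x := by
  have hp : S.pCoord K a (S.chart K a x) = x.2 := by
    rw [pCoord, chart_zero, wrap_sub_wrap, sub_sub_cancel, wrap_of_mem hx.2]
  refine Prod.ext ?_ hp
  rw [chartChange, qCoord, hp, chart_one, sub_sub, wrap_wrap_sub]
  convert wrap_of_mem hx.1 using 2
  abel

lemma E₃_eq_sum (K : Vec) (a : Fin 3) (x : Vec × Vec) :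
    S.E₃ K a x = ∑ i, S.eps i (S.chart K a x i) := by
  rw [sum_fin3 _ a, chart_zero, chart_one, chart_two, eps_wrap, eps_wrap, eps_wrap, E₃]

lemma E₃_chartChange (K : Vec) (a b : Fin 3) (x : Vec × Vec) :
    S.E₃ K b (S.chartChange K a b x) = S.E₃ K a x := by
  rw [E₃_eq_sum, chart_chartChange, ← E₃_eq_sum]

/-- The identity `l_{cb} (m_b + m_c) = m_b` matches the two parametrizations: for fixed `p` the
energy is that of a pair with momentum `(m_b + m_c) K + p`, shifted by the energy of the third
particle. -/
lemma E₃_eq_E₂ (K : Vec) (a : Fin 3) (q p : Vec) :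
    S.E₃ K a (q, p) = S.eps a (S.m a • K - p)
      + S.E₂ a ((S.m (a + 1) + S.m (a + 2)) • K + p) q := by
  have key : ∀ b c, S.lfrac c b * (S.m b + S.m c) = S.m b := fun b c => by
    have hb := S.l_pos b
    have hc := S.l_pos c
    have hM : 0 < S.totalMass := by
      unfold totalMass
      exact Finset.sum_pos (fun i _ => one_div_pos.2 (S.l_pos i)) Finset.univ_nonempty
    unfold lfrac m
    field_simp
  have e1 : S.lfrac (a + 2) (a + 1) • ((S.m (a + 1) + S.m (a + 2)) • K + p) =
      S.m (a + 1) • K + S.lfrac (a + 2) (a + 1) • p := by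
    rw [smul_add, smul_smul, key]
  have e2 : S.lfrac (a + 1) (a + 2) • ((S.m (a + 1) + S.m (a + 2)) • K + p) =
      S.m (a + 2) • K + S.lfrac (a + 1) (a + 2) • p := by
    rw [smul_add, smul_smul, add_comm (S.m (a + 1)), key]
  rw [E₃, E₂, e1, e2, add_assoc]

/-- The half-open cube is not compact, but by periodicity it has the same energies as the closed
cube. -/
lemma isCompact_image_E₃ (K : Vec) (a : Fin 3) : IsCompact (S.E₃ K a '' (torus ×ˢ torus)) := by
  have h : S.E₃ K a '' (torus ×ˢ torus) = S.E₃ K a ''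
      ((Set.pi univ fun _ => Icc (-π) π) ×ˢ (Set.pi univ fun _ => Icc (-π) π)) := by
    refine Subset.antisymm (image_mono (prod_mono ?_ ?_)) ?_
    · exact pi_mono fun _ _ => Ioc_subset_Icc_self
    · exact pi_mono fun _ _ => Ioc_subset_Icc_self
    · rintro _ ⟨x, -, rfl⟩
      exact ⟨_, S.chartChange_mem K a a x, S.E₃_chartChange K a a x⟩
  rw [h]
  have hc : IsCompact (Set.pi univ fun _ : Fin 3 => Icc (-π) π) :=
    isCompact_univ_pi fun _ => isCompact_Icc
  exact (hc.prod hc).image (S.continuous_E₃ K a)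

lemma zero_mem_torus : (0 : Vec) ∈ torus := fun _ _ =>
  ⟨neg_lt_zero.2 Real.pi_pos, Real.pi_pos.le⟩

lemma E₃_mem_Icc (K : Vec) (a b : Fin 3) (x : Vec × Vec) :
    S.E₃ K b x ∈ Icc (S.Emin K a) (S.Emax K a) := by
  have h : S.E₃ K b x ∈ S.E₃ K a '' (torus ×ˢ torus) :=
    ⟨_, S.chartChange_mem K b a x, S.E₃_chartChange K b a x⟩
  exact ⟨csInf_le (S.isCompact_image_E₃ K a).bddBelow h,
    le_csSup (S.isCompact_image_E₃ K a).bddAbove h⟩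

lemma exists_E₃_eq (K : Vec) (a : Fin 3) {t : ℝ} (ht : t ∈ Icc (S.Emin K a) (S.Emax K a)) :
    ∃ x ∈ torus ×ˢ torus, S.E₃ K a x = t := by
  have hne : (S.E₃ K a '' (torus ×ˢ torus)).Nonempty :=
    Set.Nonempty.image _ ⟨(0, 0), zero_mem_torus, zero_mem_torus⟩
  have hconv : Convex ℝ torus := convex_pi fun _ _ => convex_Ioc _ _
  have hpre := (hconv.prod hconv).isPreconnected.image _ (S.continuous_E₃ K a).continuousOn
  exact hpre.Icc_subset ((S.isCompact_image_E₃ K a).sInf_mem hne)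
    ((S.isCompact_image_E₃ K a).sSup_mem hne) ht

/-! ### The coordinate changes and the three-particle operators -/

lemma coordChange_apply (K : Vec) (a b : Fin 3) (f : L2TT) :
    S.coordChange K a b f =ᵐ[torusMeasure.prod torusMeasure] fun x => f (S.chartChange K a b x) :=
  Lp.coeFn_compMeasurePreserving _ (S.measurePreserving_chartChange K a b)

lemma norm_coordChange (K : Vec) (a b : Fin 3) (f : L2TT) : ‖S.coordChange K a b f‖ = ‖f‖ :=
  LinearIsometry.norm_map _ f

lemma coordChange_coordChange (K : Vec) (a b c : Fin 3) (f : L2TT) :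
    S.coordChange K a b (S.coordChange K b c f) = S.coordChange K a c f := by
  apply Lp.ext
  filter_upwards [S.coordChange_apply K a b (S.coordChange K b c f), S.coordChange_apply K a c f,
    (S.measurePreserving_chartChange K a b).quasiMeasurePreserving.ae
      (S.coordChange_apply K b c f)] with x h1 h2 h3
  rw [h1, h2, h3, chartChange_chartChange]

lemma coordChange_self (K : Vec) (a : Fin 3) (f : L2TT) : S.coordChange K a a f = f := by
  apply Lp.ext
  filter_upwards [S.coordChange_apply K a a f, ae_mem_torus_prod] with x h1 h2
  rw [h1, S.chartChange_self K a h2]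

lemma inner_coordChange (K : Vec) (a b : Fin 3) (f g : L2TT) :
    ⟪S.coordChange K a b f, g⟫_ℂ = ⟪f, S.coordChange K b a g⟫_ℂ := by
  conv_lhs => rw [← S.coordChange_self K a g, ← S.coordChange_coordChange K a b a]
  let U : L2TT →ₗᵢ[ℂ] L2TT := Lp.compMeasurePreservingₗᵢ ℂ (S.chartChange K a b)
    (S.measurePreserving_chartChange K a b)
  exact U.inner_map_map _ _

lemma V_apply (K : Vec) (a b : Fin 3) (f : L2TT) :
    S.V K a b f = S.coordChange K a b (S.Vown b (S.coordChange K b a f)) := rfl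

lemma V_self (K : Vec) (a : Fin 3) (f : L2TT) : S.V K a a f = S.Vown a f := by
  rw [V_apply, coordChange_self, coordChange_self]

lemma coordChange_V (K : Vec) (a b c : Fin 3) (f : L2TT) :
    S.coordChange K a b (S.V K b c f) = S.V K a c (S.coordChange K a b f) := by
  rw [V_apply, V_apply, coordChange_coordChange, coordChange_coordChange]

/-- Multiplication by the kinetic energy in the coordinates `(q_a, p_a)`. -/
def H₀ (K : Vec) (a : Fin 3) : L2TT →L[ℂ] L2TT :=
  mulOp (S.E₃ K a) (S.continuous_E₃ K a).measurable (S.exists_E₃_le K a)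

lemma H₀_apply (K : Vec) (a : Fin 3) (f : L2TT) :
    S.H₀ K a f =ᵐ[torusMeasure.prod torusMeasure] fun x => (S.E₃ K a x : ℂ) * f x :=
  mulOp_apply _ _ _ f

lemma H_apply (K : Vec) (a : Fin 3) (f : L2TT) :
    S.H K a f = S.H₀ K a f - ∑ b, S.V K a b f := by
  simp [H, H₀]

lemma coordChange_H₀ (K : Vec) (a b : Fin 3) (f : L2TT) :
    S.coordChange K a b (S.H₀ K b f) = S.H₀ K a (S.coordChange K a b f) := by
  apply Lp.ext
  filter_upwards [S.coordChange_apply K a b (S.H₀ K b f), S.coordChange_apply K a b f,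
    (S.measurePreserving_chartChange K a b).quasiMeasurePreserving.ae (S.H₀_apply K b f),
    S.H₀_apply K a (S.coordChange K a b f)] with x h1 h2 h3 h4
  rw [h1, h3, h4, h2, E₃_chartChange]

lemma coordChange_H (K : Vec) (a b : Fin 3) (f : L2TT) :
    S.coordChange K a b (S.H K b f) = S.H K a (S.coordChange K a b f) := by
  simp only [H_apply, map_sub, map_sum, coordChange_H₀, coordChange_V]

lemma isSelfAdjoint_Vown (b : Fin 3) : IsSelfAdjoint (S.Vown b) :=
  IsSelfAdjoint.smul (Complex.conj_ofReal _ : IsSelfAdjoint _) isSelfAdjoint_avgFst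

lemma isSelfAdjoint_V (K : Vec) (a b : Fin 3) : IsSelfAdjoint (S.V K a b) := by
  refine isSelfAdjoint_of_symm fun f g => ?_
  have h : ∀ f g, ⟪S.Vown b f, g⟫_ℂ = ⟪f, S.Vown b g⟫_ℂ :=
    ContinuousLinearMap.isSelfAdjoint_iff_isSymmetric.1 (S.isSelfAdjoint_Vown b)
  rw [V_apply, V_apply, inner_coordChange, h, ← inner_coordChange]

lemma isSelfAdjoint_H (K : Vec) (a : Fin 3) : IsSelfAdjoint (S.H K a) :=
  (isSelfAdjoint_mulOp _ _ _).sub (isSelfAdjoint_sum _ fun b _ => S.isSelfAdjoint_V K a b)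

lemma isSelfAdjoint_h (a : Fin 3) (k : Vec) : IsSelfAdjoint (S.h a k) :=
  (isSelfAdjoint_mulOp _ _ _).sub
    (IsSelfAdjoint.smul (Complex.conj_ofReal _ : IsSelfAdjoint _) isSelfAdjoint_avg)

end System

/-! ### Lower bounds for multiplications, rank-one averages and eigenvalues. -/

section L2

variable {X : Type*} [MeasurableSpace X] {ν : Measure X}

lemma mul_norm_le_norm_mulOp_sub {g : X → ℝ} (hg : Measurable g) (hb : ∃ C, ∀ x, |g x| ≤ C)
    {t δ : ℝ} (hδ : 0 < δ) (h : ∀ x, δ ≤ |g x - t|) (f : Lp ℂ 2 ν) :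
    δ * ‖f‖ ≤ ‖mulOp g hg hb f - (t : ℂ) • f‖ := by
  have := L2_norm_le_of_ae_le (f := f) (g := mulOp g hg hb f - (t : ℂ) • f) (C := δ⁻¹) (by
    filter_upwards [Lp.coeFn_sub (mulOp g hg hb f) ((t : ℂ) • f), mulOp_apply g hg hb f,
      Lp.coeFn_smul (t : ℂ) f] with x h1 h2 h3
    rw [h1, Pi.sub_apply, h2, h3, Pi.smul_apply, smul_eq_mul, ← sub_mul, norm_mul,
      ← Complex.ofReal_sub, Complex.norm_real, Real.norm_eq_abs, ← div_eq_inv_mul, le_div_iff₀ hδ,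
      mul_comm]
    exact mul_le_mul_of_nonneg_right (h x) (norm_nonneg _))
  rwa [← div_eq_inv_mul, le_div_iff₀ hδ, mul_comm] at this

lemma WeaklyNull.tendsto_avg [IsFiniteMeasure ν] {f : ℕ → Lp ℂ 2 ν} (hf : WeaklyNull f) :
    Tendsto (fun n => avg (f n)) atTop (𝓝 0) := by
  refine (hf.map avg).tendsto_of_finiteDimensional (Submodule.span ℂ {Lp.constL 2 ν ℂ (1 : ℂ)})
    fun n => Submodule.mem_span_singleton.2 ⟨∫ q, f n q ∂ν, ?_⟩
  rw [← map_smul, smul_eq_mul, mul_one]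
  rfl

lemma integral_comp_measurePreserving {φ : X → X} (hφ : MeasurePreserving φ ν ν) {f : X → ℝ}
    (hf : Measurable f) : ∫ x, f (φ x) ∂ν = ∫ x, f x ∂ν := by
  conv_rhs => rw [← hφ.map_eq]
  rw [integral_map hφ.measurable.aemeasurable hf.aestronglyMeasurable]

lemma mem_spectrum_of_hasEigenvalue {E : Type*} [NormedAddCommGroup E] [InnerProductSpace ℂ E]
    {A : E →L[ℂ] E} {z : ℂ} {f : E} (hf : f ≠ 0) (h : A f = z • f) : z ∈ spectrum ℂ A := by
  intro hz
  obtain ⟨u, hu⟩ := hz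
  have h1 := congrArg (fun T : E →L[ℂ] E => T f) u.inv_mul
  rw [hu] at h1
  simp [Algebra.algebraMap_eq_smul_one, h] at h1
  exact hf h1.symm

end L2

/-! ### Two-particle eigenvalues and the Fredholm determinant. -/

namespace System

variable (S : System)

/-- The coupling constant `μ_b (2π)⁻³`. -/
def coupling (b : Fin 3) : ℝ := S.μ b / (2 * π) ^ 3

lemma Vown_apply (b : Fin 3) (f : L2TT) : S.Vown b f = (S.coupling b : ℂ) • avgFst f := rfl

lemma h_apply (b : Fin 3) (k : Vec) (f : L2T) :
    S.h b k f = mulOp (S.E₂ b k) (S.continuous_E₂ b k).measurable (S.exists_E₂_le b k) f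
      - (S.coupling b : ℂ) • avg f := rfl

/-- The pair interaction has rank one, so the integral condition makes `(E₂ - z)⁻¹` an
eigenfunction. The eigenvalue is discrete: along a weakly null sequence the averages vanish in the
limit, and multiplication by `E₂ - z` is bounded below by `δ`. -/
lemma mem_discreteSpectrum_h (b : Fin 3) (k : Vec) {z δ : ℝ} (hδ : 0 < δ)
    (hE : ∀ q, δ ≤ |S.E₂ b k q - z|)
    (hz : S.coupling b * ∫ q, (S.E₂ b k q - z)⁻¹ ∂torusMeasure = 1) :
    (z : ℂ) ∈ discreteSpectrum (S.h b k) := by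
  have hne : ∀ q, S.E₂ b k q - z ≠ 0 := fun q h0 => by
    have := hE q; rw [h0, abs_zero] at this; linarith
  have hmem : MemLp (fun q => (((S.E₂ b k q - z)⁻¹ : ℝ) : ℂ)) 2 torusMeasure := by
    refine MemLp.of_bound (Complex.measurable_ofReal.comp
      ((S.continuous_E₂ b k).measurable.sub_const z).inv).aestronglyMeasurable δ⁻¹
      (Eventually.of_forall fun q => ?_)
    rw [Complex.norm_real, norm_inv, Real.norm_eq_abs]
    exact inv_anti₀ hδ (hE q)
  have hint : ∫ q, hmem.toLp _ q ∂torusMeasure =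
      ((∫ q, (S.E₂ b k q - z)⁻¹ ∂torusMeasure : ℝ) : ℂ) := by
    rw [integral_congr_ae hmem.coeFn_toLp, integral_complex_ofReal]
  have heig : S.h b k (hmem.toLp _) = (z : ℂ) • hmem.toLp _ := by
    apply Lp.ext
    rw [h_apply]
    filter_upwards [Lp.coeFn_sub (mulOp (S.E₂ b k) (S.continuous_E₂ b k).measurable
      (S.exists_E₂_le b k) (hmem.toLp _)) ((S.coupling b : ℂ) • avg (hmem.toLp _)),
      mulOp_apply (S.E₂ b k) (S.continuous_E₂ b k).measurable (S.exists_E₂_le b k) (hmem.toLp _),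
      Lp.coeFn_smul (S.coupling b : ℂ) (avg (hmem.toLp _)), avg_apply (hmem.toLp _),
      Lp.coeFn_smul (z : ℂ) (hmem.toLp _), hmem.coeFn_toLp] with q h1 h2 h3 h4 h5 h6
    rw [h1, Pi.sub_apply, h2, h3, Pi.smul_apply, h4, h5, Pi.smul_apply, h6, hint, smul_eq_mul,
      smul_eq_mul, ← Complex.ofReal_mul (S.coupling b), hz, ← Complex.ofReal_mul,
      ← Complex.ofReal_mul, ← Complex.ofReal_sub]
    congr 1
    field_simp [hne q]
    ring
  have hne0 : hmem.toLp _ ≠ 0 := fun h0 => by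
    have h1 : ∫ q, hmem.toLp _ q ∂torusMeasure = 0 := by
      rw [h0, integral_congr_ae (Lp.coeFn_zero ℂ 2 torusMeasure)]; simp
    rw [hint] at h1
    rw [Complex.ofReal_eq_zero.1 h1, mul_zero] at hz
    exact zero_ne_one hz
  refine mem_discreteSpectrum_of_no_weaklyNull (S.isSelfAdjoint_h b k)
    (mem_spectrum_of_hasEigenvalue hne0 heig) fun f hf1 hfw hf0 => ?_
  have h1 := hf0.add (hfw.tendsto_avg.const_smul (S.coupling b : ℂ))
  simp only [h_apply, smul_zero, add_zero] at h1
  have h2 := h1.norm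
  rw [norm_zero] at h2
  have h3 := le_of_tendsto_of_tendsto (tendsto_const_nhds (x := δ)) h2
    (Eventually.of_forall fun n => by
      have := mul_norm_le_norm_mulOp_sub (S.continuous_E₂ b k).measurable
        (S.exists_E₂_le b k) hδ hE (f n)
      rw [hf1, mul_one] at this
      refine this.trans_eq ?_
      congr 1
      abel)
  linarith

/-- The Fredholm determinant of the subsystem `b` at the energy `t` and the momentum `p`. -/
def fredholmDet (K : Vec) (b : Fin 3) (t : ℝ) (p : Vec) : ℝ :=
  1 - S.coupling b * ∫ q, (S.E₃ K b (q, p) - t)⁻¹ ∂torusMeasure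

section Resolvent

variable {S} {K : Vec} {b : Fin 3} {t δ : ℝ}

lemma measurable_inv_E₃ (b : Fin 3) (t : ℝ) : Measurable fun x => (S.E₃ K b x - t)⁻¹ :=
  ((S.continuous_E₃ K b).measurable.sub_const t).inv

lemma abs_inv_E₃_le (hδ : 0 < δ) (hE : ∀ x, δ ≤ |S.E₃ K b x - t|) (x : Vec × Vec) :
    |(S.E₃ K b x - t)⁻¹| ≤ δ⁻¹ := by
  rw [abs_inv]; exact inv_anti₀ hδ (hE x)

lemma continuous_fredholmDet (hδ : 0 < δ) (hE : ∀ x, δ ≤ |S.E₃ K b x - t|) :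
    Continuous (S.fredholmDet K b t) := by
  refine continuous_const.sub (continuous_const.mul ?_)
  refine continuous_of_dominated (bound := fun _ => δ⁻¹) (fun p => ?_) (fun p => ?_)
    (integrable_const _) (Eventually.of_forall fun q => ?_)
  · exact ((measurable_inv_E₃ b t).comp (by fun_prop)).aestronglyMeasurable
  · exact Eventually.of_forall fun q => abs_inv_E₃_le hδ hE _
  · refine Continuous.inv₀ (((S.continuous_E₃ K b).comp (by fun_prop)).sub continuous_const)
      fun p h0 => ?_
    have := hE (q, p)
    rw [h0, abs_zero] at this
    linarith

/-- A lattice shift of `p` moves the fractions `l_{cb} p` by non-lattice vectors; a translation of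
`q` compensates for this, and the integral over the torus absorbs it. -/
lemma fredholmDet_wrap (p : Vec) : S.fredholmDet K b t (wrap p) = S.fredholmDet K b t p := by
  have h : ∀ q, S.E₃ K b (q, p) = S.E₃ K b
      (wrap ((S.lfrac (b + 2) (b + 1) • p - S.lfrac (b + 2) (b + 1) • wrap p) + q), wrap p) := by
    intro q
    rw [← S.E₃_chartChange K b b (q, p)]
    congr 1
    have hp : S.pCoord K b (S.chart K b (q, p)) = wrap p := by
      rw [pCoord, chart_zero, wrap_sub_wrap, sub_sub_cancel]
    refine Prod.ext ?_ hp
    rw [chartChange, qCoord, hp, chart_one, sub_sub, wrap_wrap_sub]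
    refine congrArg wrap ?_
    dsimp only
    abel
  rw [fredholmDet, fredholmDet]
  congr 2
  simp only [h]
  exact (integral_comp_measurePreserving (measurePreserving_wrap _).1
    (f := fun q => (S.E₃ K b (q, wrap p) - t)⁻¹)
    ((measurable_inv_E₃ b t).comp (by fun_prop))).symm

lemma exists_le_abs_fredholmDet (hδ : 0 < δ) (hE : ∀ x, δ ≤ |S.E₃ K b x - t|)
    (hne : ∀ p ∈ torus, S.fredholmDet K b t p ≠ 0) :
    ∃ η > 0, ∀ p, η ≤ |S.fredholmDet K b t p| := by
  have hc : IsCompact (Set.pi univ fun _ : Fin 3 => Icc (-π) π) :=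
    isCompact_univ_pi fun _ => isCompact_Icc
  obtain ⟨p₀, -, hp₀⟩ := hc.exists_isMinOn
    ⟨0, fun _ _ => Ioc_subset_Icc_self (zero_mem_torus _ trivial)⟩
    (continuous_fredholmDet hδ hE).abs.continuousOn
  refine ⟨_, abs_pos.2 (hne (wrap p₀) (wrap_mem p₀)), fun p => ?_⟩
  rw [fredholmDet_wrap, ← fredholmDet_wrap p]
  exact hp₀ (fun i _ => Ioc_subset_Icc_self (wrap_mem p i trivial))

/-- For fixed `p_b`, the momentum of each particle of the pair `b` is an affine function of `q_b`
with slope `1` or `-1`. This transversality is what makes the mixed terms vanish along weakly null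
sequences. -/
lemma measurePreserving_chartChange_slice (K : Vec) {b c : Fin 3} (hbc : c ≠ b) (p : Vec) :
    MeasurePreserving (fun q => (S.chartChange K b c (q, p)).2) torusMeasure torusMeasure := by
  rcases fin3_cases b c with rfl | rfl | rfl
  · exact absurd rfl hbc
  · have h : (fun q => (S.chartChange K b (b + 1) (q, p)).2) = fun q =>
        wrap (S.m (b + 1) • K - (S.m (b + 1) • K + S.lfrac (b + 2) (b + 1) • p) - q) := by
      funext q
      rw [chartChange, pCoord, chart_one, wrap_sub_wrap, sub_sub]
    rw [h]
    exact (measurePreserving_wrap _).2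
  · have h : (fun q => (S.chartChange K b (b + 2) (q, p)).2) = fun q =>
        wrap (S.m (b + 2) • K - (S.m (b + 2) • K + S.lfrac (b + 1) (b + 2) • p) + q) := by
      funext q
      rw [chartChange, pCoord, chart_two, wrap_sub_wrap, sub_sub_eq_add_sub, add_sub_right_comm]
    rw [h]
    exact (measurePreserving_wrap _).1

/-- A Faddeev-type argument: averaging `R (H - t) u` eliminates the interactions of the other pairs,
and the equation left for the average of `u` is multiplication by the Fredholm determinant, which is
invertible. -/
lemma tendsto_Vown (hδ : 0 < δ) (hE : ∀ x, δ ≤ |S.E₃ K b x - t|)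
    (hne : ∀ p ∈ torus, S.fredholmDet K b t p ≠ 0) {u : ℕ → L2TT} (hu1 : ∀ n, ‖u n‖ = 1)
    (huw : WeaklyNull u) (hu : Tendsto (fun n => S.H K b (u n) - (t : ℂ) • u n) atTop (𝓝 0)) :
    Tendsto (fun n => S.Vown b (u n)) atTop (𝓝 0) := by
  obtain ⟨η, hη, hdet⟩ := exists_le_abs_fredholmDet hδ hE hne
  have hRb : ∃ C, ∀ x, |(S.E₃ K b x - t)⁻¹| ≤ C := ⟨_, abs_inv_E₃_le hδ hE⟩
  let R : L2TT →L[ℂ] L2TT := mulOp _ (measurable_inv_E₃ b t) hRb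
  have hRinv : ∀ f, R (S.H₀ K b f - (t : ℂ) • f) = f := fun f => by
    apply Lp.ext
    filter_upwards [mulOp_apply _ (measurable_inv_E₃ b t) hRb (S.H₀ K b f - (t : ℂ) • f),
      S.H₀_apply K b f, Lp.coeFn_sub (S.H₀ K b f) ((t : ℂ) • f), Lp.coeFn_smul (t : ℂ) f]
      with x h1 h2 h3 h4
    have hx : (S.E₃ K b x - t : ℂ) ≠ 0 := fun h0 => by
      have := hE x
      rw [← Complex.ofReal_sub, Complex.ofReal_eq_zero] at h0
      rw [h0, abs_zero] at this
      linarith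
    rw [h1, h3, Pi.sub_apply, h2, h4, Pi.smul_apply, smul_eq_mul, ← sub_mul, ← mul_assoc]
    push_cast
    rw [inv_mul_cancel₀ hx, one_mul]
  -- The only place where weak convergence to zero is used.
  have hoff : ∀ c, c ≠ b → Tendsto (fun n => avgFst (R (S.V K b c (u n)))) atTop (𝓝 0) := by
    intro c hc
    have h := (tendsto_avgFst_mulOp_comp _ (measurable_inv_E₃ b t) hRb (S.chartChange K b c)
      (S.measurePreserving_chartChange K b c) (measurePreserving_chartChange_slice K hc)
      (fun n => S.coordChange K c b (u n)) (fun n => (S.norm_coordChange K c b (u n)).le.trans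
        (hu1 n).le) (huw.map (S.coordChange K c b))).const_smul (S.coupling c : ℂ)
    rw [smul_zero] at h
    refine h.congr fun n => ?_
    rw [V_apply, Vown_apply, map_smul, map_smul, map_smul]
    rfl
  have hmain : Tendsto (fun n => avgFst (u n) - avgFst (R (S.Vown b (u n)))) atTop (𝓝 0) := by
    have h0 : Tendsto (fun n => avgFst (R (S.H K b (u n) - (t : ℂ) • u n))) atTop (𝓝 0) := by
      have := ((avgFst (ν := torusMeasure) (ρ := torusMeasure)).comp R).continuous.tendsto 0
      rw [map_zero] at this
      exact this.comp hu
    have h1 := (h0.add (hoff (b + 1) (fin3_cyc b).1)).add (hoff (b + 2) (fin3_cyc b).2.1)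
    simp only [add_zero] at h1
    refine h1.congr fun n => ?_
    have e : S.H K b (u n) - (t : ℂ) • u n = (S.H₀ K b (u n) - (t : ℂ) • u n)
        - S.Vown b (u n) - S.V K b (b + 1) (u n) - S.V K b (b + 2) (u n) := by
      rw [H_apply, sum_fin3 _ b, V_self]; abel
    rw [e, map_sub R, map_sub R, map_sub R, hRinv, map_sub, map_sub, map_sub]
    abel
  -- On functions of `p` alone, `R` followed by averaging is multiplication by `∫ (E₃ - t)⁻¹ dq`, so
  -- the right-hand side is the norm of the determinant times `avgFst f`.
  have hkey : ∀ f : L2TT, η * ‖avgFst f‖ ≤ ‖avgFst f - avgFst (R (S.Vown b f))‖ := by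
    intro f
    have := L2_norm_le_of_ae_le (f := avgFst f) (g := avgFst f - avgFst (R (S.Vown b f)))
      (C := η⁻¹) (by
      rw [Vown_apply, map_smul, map_smul]
      filter_upwards [avgFst_apply f, Lp.coeFn_sub (avgFst f)
        ((S.coupling b : ℂ) • avgFst (R (avgFst f))),
        Lp.coeFn_smul (S.coupling b : ℂ) (avgFst (R (avgFst f))), avgFst_apply (R (avgFst f)),
        ae_slice (mulOp_apply _ (measurable_inv_E₃ b t) hRb (avgFst f)),
        ae_slice (avgFst_apply f)] with x h1 h2 h3 h4 h5 h6
      have h7 : ∫ q, R (avgFst f) (q, x.2) ∂torusMeasure =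
          ((∫ q, (S.E₃ K b (q, x.2) - t)⁻¹ ∂torusMeasure : ℝ) : ℂ)
            * ∫ q, f (q, x.2) ∂torusMeasure := by
        rw [← integral_complex_ofReal, ← integral_mul_const]
        refine integral_congr_ae ?_
        filter_upwards [h5, h6] with q k5 k6
        rw [k5, k6]
      have h8 : (avgFst f - (S.coupling b : ℂ) • avgFst (R (avgFst f))) x =
          (S.fredholmDet K b t x.2 : ℂ) * avgFst f x := by
        rw [h2, Pi.sub_apply, h3, Pi.smul_apply, h4, h7, h1, fredholmDet, smul_eq_mul]
        push_cast
        ring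
      rw [h8, norm_mul, Complex.norm_real, Real.norm_eq_abs, ← div_eq_inv_mul, le_div_iff₀ hη,
        mul_comm]
      exact mul_le_mul_of_nonneg_right (hdet _) (norm_nonneg _))
    rwa [← div_eq_inv_mul, le_div_iff₀ hη, mul_comm] at this
  have havg : Tendsto (fun n => avgFst (u n)) atTop (𝓝 0) := by
    refine squeeze_zero_norm (a := fun n => η⁻¹ * ‖avgFst (u n) - avgFst (R (S.Vown b (u n)))‖)
      (fun n => ?_) (by simpa using hmain.norm.const_mul η⁻¹)
    rw [← div_eq_inv_mul, le_div_iff₀ hη, mul_comm]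
    exact hkey (u n)
  simpa [Vown_apply] using havg.const_smul (S.coupling b : ℂ)

end Resolvent

/-! ### The upper inclusion. -/

theorem essentialSpectrum_H_subset (K : Vec) (a : Fin 3) :
    essentialSpectrum (S.H K a) ⊆
      (⋃ b : Fin 3, ⋃ p ∈ torus, (fun z : ℂ => z + (S.eps b (S.m b • K - p) : ℂ)) ''
          discreteSpectrum (S.h b ((S.m (b + 1) + S.m (b + 2)) • K + p))) ∪
      (fun t : ℝ => (t : ℂ)) '' Icc (S.Emin K a) (S.Emax K a) := by
  rintro z ⟨hz, hzd⟩
  by_contra hcon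
  rw [mem_union, not_or] at hcon
  obtain ⟨hcon1, hcon2⟩ := hcon
  obtain ⟨t, rfl⟩ : ∃ t : ℝ, z = t := ⟨_, (S.isSelfAdjoint_H K a).mem_spectrum_eq_re hz⟩
  have ht : t ∉ Icc (S.Emin K a) (S.Emax K a) := fun ht => hcon2 ⟨t, ht, rfl⟩
  obtain ⟨δ, hδ, hE⟩ : ∃ δ > 0, ∀ b x, δ ≤ |S.E₃ K b x - t| := by
    rw [mem_Icc, not_and_or, not_le, not_le] at ht
    rcases ht with ht | ht
    · refine ⟨S.Emin K a - t, by linarith, fun b x => ?_⟩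
      have := (S.E₃_mem_Icc K a b x).1
      exact le_trans (by linarith) (le_abs_self _)
    · refine ⟨t - S.Emax K a, by linarith, fun b x => ?_⟩
      have := (S.E₃_mem_Icc K a b x).2
      exact le_trans (by linarith) (neg_le_abs _)
  have hne : ∀ b, ∀ p ∈ torus, S.fredholmDet K b t p ≠ 0 := by
    intro b p hp h0
    refine hcon1 (mem_iUnion.2 ⟨b, mem_iUnion₂.2 ⟨p, hp,
      ((t - S.eps b (S.m b • K - p) : ℝ) : ℂ), ?_, by push_cast; ring⟩⟩)
    have e : ∀ q, S.E₃ K b (q, p) - t = S.E₂ b ((S.m (b + 1) + S.m (b + 2)) • K + p) q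
        - (t - S.eps b (S.m b • K - p)) := fun q => by rw [E₃_eq_E₂]; ring
    refine S.mem_discreteSpectrum_h b _ hδ (fun q => ?_) ?_
    · rw [← e]; exact hE b _
    · simp only [← e]
      rw [fredholmDet] at h0
      linarith
  refine hzd (mem_discreteSpectrum_of_no_weaklyNull (S.isSelfAdjoint_H K a) hz
    fun f hf1 hfw hf0 => ?_)
  -- Each interaction is treated in its own coordinates and the result is transported back.
  have hV : ∀ b, Tendsto (fun n => S.V K a b (f n)) atTop (𝓝 0) := by
    intro b
    have h1 := tendsto_Vown hδ (hE b) (hne b) (u := fun n => S.coordChange K b a (f n))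
      (fun n => (S.norm_coordChange K b a _).trans (hf1 n)) (hfw.map _) (by
        have h2 := ((S.coordChange K b a).continuous.tendsto 0).comp hf0
        rw [map_zero] at h2
        refine h2.congr fun n => ?_
        rw [Function.comp_apply, map_sub, map_smul, coordChange_H])
    have h3 := ((S.coordChange K a b).continuous.tendsto 0).comp h1
    rw [map_zero] at h3
    exact h3
  have h1 := hf0.add (tendsto_finsetSum Finset.univ fun b _ => hV b)
  rw [Finset.sum_const_zero, add_zero] at h1
  have h2 := h1.norm
  rw [norm_zero] at h2
  have h3 := le_of_tendsto_of_tendsto (tendsto_const_nhds (x := δ)) h2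
    (Eventually.of_forall fun n => by
      dsimp only
      have h4 : δ * ‖f n‖ ≤ ‖S.H₀ K a (f n) - (t : ℂ) • f n‖ := mul_norm_le_norm_mulOp_sub
        (S.continuous_E₃ K a).measurable (S.exists_E₃_le K a) hδ (hE a) (f n)
      rw [hf1, mul_one] at h4
      refine h4.trans_eq ?_
      rw [H_apply]
      congr 1
      abel)
  linarith

/-! ### Modulated sequences. -/

lemma measurable_chart (K : Vec) (a i : Fin 3) : Measurable fun x => S.chart K a x i := by
  rcases fin3_cases a i with rfl | rfl | rfl
  · simp only [chart_zero]
    exact measurable_wrap.comp (by fun_prop)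
  · simp only [chart_one]
    exact measurable_wrap.comp (by fun_prop)
  · simp only [chart_two]
    exact measurable_wrap.comp (by fun_prop)

/-- The character `exp (i n ∑ⱼ dⱼ kⱼ⁽¹⁾)` of the particle momenta `k`, in the coordinates
`(q_a, p_a)`. -/
def phase (K : Vec) (a : Fin 3) (d : Fin 3 → ℤ) (n : ℕ) (x : Vec × Vec) : ℂ :=
  Complex.exp ((n * ∑ j, d j * S.chart K a x j 0 : ℝ) * Complex.I)

lemma measurable_phase (K : Vec) (a : Fin 3) (d : Fin 3 → ℤ) (n : ℕ) :
    Measurable (S.phase K a d n) := by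
  have h : Measurable fun x => (n * ∑ j, d j * S.chart K a x j 0 : ℝ) :=
    measurable_const.mul (Finset.measurable_sum _ fun j _ =>
      measurable_const.mul ((measurable_pi_apply 0).comp (S.measurable_chart K a j)))
  exact Complex.measurable_exp.comp ((Complex.measurable_ofReal.comp h).mul_const _)

lemma norm_phase (K : Vec) (a : Fin 3) (d : Fin 3 → ℤ) (n : ℕ) (x : Vec × Vec) :
    ‖S.phase K a d n x‖ = 1 := Complex.norm_exp_ofReal_mul_I _

lemma phase_chartChange (K : Vec) (a b : Fin 3) (d : Fin 3 → ℤ) (n : ℕ) (x : Vec × Vec) :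
    S.phase K b d n (S.chartChange K a b x) = S.phase K a d n x := by
  rw [phase, chart_chartChange, phase]

/-- Since `n` and the `d j` are integers, reduction modulo `2π` does not change the exponential; the
exponent may be taken affine in `(q, p)`. -/
lemma phase_eq (K : Vec) (a : Fin 3) (d : Fin 3 → ℤ) (n : ℕ) (x : Vec × Vec) :
    S.phase K a d n x = Complex.exp ((n * (d a * (S.m a * K 0 - x.2 0)
      + d (a + 1) * (S.m (a + 1) * K 0 + S.lfrac (a + 2) (a + 1) * x.2 0 + x.1 0)
      + d (a + 2) * (S.m (a + 2) * K 0 + S.lfrac (a + 1) (a + 2) * x.2 0 - x.1 0)) : ℝ)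
        * Complex.I) := by
  rw [phase, sum_fin3 _ a, chart_zero, chart_one, chart_two]
  obtain ⟨N₀, h₀⟩ := wrap_spec (S.m a • K - x.2) 0
  obtain ⟨N₁, h₁⟩ := wrap_spec (S.m (a + 1) • K + S.lfrac (a + 2) (a + 1) • x.2 + x.1) 0
  obtain ⟨N₂, h₂⟩ := wrap_spec (S.m (a + 2) • K + S.lfrac (a + 1) (a + 2) • x.2 - x.1) 0
  rw [h₀, h₁, h₂, Complex.exp_eq_exp_iff_exists_int]
  refine ⟨n * (d a * N₀ + d (a + 1) * N₁ + d (a + 2) * N₂), ?_⟩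
  simp only [Pi.add_apply, Pi.sub_apply, Pi.smul_apply, smul_eq_mul]
  push_cast
  ring

/-- The product of an element of `L₂` with the character `phase`. -/
def modulate (K : Vec) (a : Fin 3) (d : Fin 3 → ℤ) (F : L2TT) (n : ℕ) : L2TT :=
  twist (S.phase K a d n) (S.measurable_phase K a d n) (S.norm_phase K a d n) F

lemma modulate_apply (K : Vec) (a : Fin 3) (d : Fin 3 → ℤ) (F : L2TT) (n : ℕ) :
    S.modulate K a d F n =ᵐ[torusMeasure.prod torusMeasure] fun x => S.phase K a d n x * F x :=
  twist_apply _ _ _ F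

lemma norm_modulate (K : Vec) (a : Fin 3) (d : Fin 3 → ℤ) (F : L2TT) (n : ℕ) :
    ‖S.modulate K a d F n‖ = ‖F‖ := norm_twist _ _ _ F

lemma coordChange_modulate (K : Vec) (a c : Fin 3) (d : Fin 3 → ℤ) (F : L2TT) (n : ℕ) :
    S.coordChange K c a (S.modulate K a d F n) = S.modulate K c d (S.coordChange K c a F) n := by
  apply Lp.ext
  filter_upwards [S.coordChange_apply K c a (S.modulate K a d F n), S.coordChange_apply K c a F,
    (S.measurePreserving_chartChange K c a).quasiMeasurePreserving.ae (S.modulate_apply K a d F n),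
    S.modulate_apply K c d (S.coordChange K c a F) n] with x h1 h2 h3 h4
  rw [h1, h3, h4, h2, phase_chartChange]

/-- The linear part of the exponent vanishes only if all `d j` agree, when the phase sees only the
conserved total momentum. Otherwise the Riemann-Lebesgue lemma applies to each inner product. -/
lemma weaklyNull_modulate (K : Vec) (a : Fin 3) {d : Fin 3 → ℤ}
    (hd : ¬ (d a = d (a + 1) ∧ d (a + 1) = d (a + 2))) (F : L2TT) :
    WeaklyNull (S.modulate K a d F) := by
  intro G
  let π₁ : Vec × Vec →L[ℝ] ℝ := (ContinuousLinearMap.proj 0).comp (ContinuousLinearMap.fst ℝ Vec Vec)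
  let π₂ : Vec × Vec →L[ℝ] ℝ := (ContinuousLinearMap.proj 0).comp (ContinuousLinearMap.snd ℝ Vec Vec)
  let L : Vec × Vec →L[ℝ] ℝ := (-(d a : ℝ) + d (a + 1) * S.lfrac (a + 2) (a + 1)
    + d (a + 2) * S.lfrac (a + 1) (a + 2)) • π₂ + ((d (a + 1) : ℝ) - d (a + 2)) • π₁
  have hLx : ∀ x, L x = (-(d a : ℝ) + d (a + 1) * S.lfrac (a + 2) (a + 1)
    + d (a + 2) * S.lfrac (a + 1) (a + 2)) * x.2 0 + ((d (a + 1) : ℝ) - d (a + 2)) * x.1 0 :=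
    fun x => rfl
  have hL : L ≠ 0 := by
    intro h0
    have e1 := hLx (fun _ => 1, 0)
    have e2 := hLx (0, fun _ => 1)
    rw [h0] at e1 e2
    simp only [zero_apply, Pi.zero_apply, mul_zero, mul_one, zero_add,
      add_zero] at e1 e2
    have e3 := S.lfrac_add (a + 1) (a + 2)
    have e4 : (d (a + 1) : ℝ) = d (a + 2) := by linarith
    rw [← e4] at e2
    have e5 : (d a : ℝ) = d (a + 1) := by linear_combination e2 + d (a + 1) * e3
    exact hd ⟨by exact_mod_cast e5, by exact_mod_cast e4⟩
  have := Measure.prod.instIsAddHaarMeasure (volume : Measure Vec) (volume : Measure Vec)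
  have h := tendsto_integral_exp_mul ((volume : Measure Vec).prod (volume : Measure Vec)) L hL
    (d a * (S.m a * K 0) + d (a + 1) * (S.m (a + 1) * K 0) + d (a + 2) * (S.m (a + 2) * K 0))
    (torus ×ˢ torus) (measurableSet_torus.prod measurableSet_torus)
    (fun x => (starRingEnd ℂ) (G x) * F x)
  rw [← Measure.prod_restrict] at h
  refine h.congr fun n => ?_
  rw [L2_inner_eq]
  refine integral_congr_ae ?_
  filter_upwards [S.modulate_apply K a d F n] with x hx
  rw [hx, phase_eq, hLx, mul_left_comm]
  congr 5
  ring

/-- The variable `q_c` enters `k_{c+1}` with sign plus and `k_{c+2}` with sign minus, so on each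
slice the phase oscillates in `q_c` with frequency `n (d (c + 1) - d (c + 2))`. -/
lemma tendsto_avgFst_modulate (K : Vec) (c : Fin 3) {d : Fin 3 → ℤ}
    (hd : d (c + 1) ≠ d (c + 2)) (G : L2TT) :
    Tendsto (fun n => avgFst (S.modulate K c d G n)) atTop (𝓝 0) := by
  refine tendsto_avgFst_twist G (S.phase K c d) (S.measurable_phase K c d) (S.norm_phase K c d)
    fun p => ?_
  let L : Vec →L[ℝ] ℝ := ((d (c + 1) : ℝ) - d (c + 2)) • ContinuousLinearMap.proj 0
  have hLx : ∀ x, L x = ((d (c + 1) : ℝ) - d (c + 2)) * x 0 := fun x => rfl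
  have hL : L ≠ 0 := by
    intro h0
    have e1 := hLx (fun _ => 1)
    rw [h0] at e1
    simp only [zero_apply, mul_one] at e1
    exact hd (by exact_mod_cast (sub_eq_zero.1 e1.symm))
  have h := tendsto_integral_exp_mul volume L hL
    (d c * (S.m c * K 0 - p 0)
      + d (c + 1) * (S.m (c + 1) * K 0 + S.lfrac (c + 2) (c + 1) * p 0)
      + d (c + 2) * (S.m (c + 2) * K 0 + S.lfrac (c + 1) (c + 2) * p 0))
    torus measurableSet_torus (fun q => G (q, p))
  refine h.congr fun n => ?_
  refine integral_congr_ae (Eventually.of_forall fun q => ?_)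
  dsimp only
  rw [phase_eq, hLx]
  congr 4
  dsimp only
  ring

lemma tendsto_V_modulate (K : Vec) (a c : Fin 3) {d : Fin 3 → ℤ}
    (hd : d (c + 1) ≠ d (c + 2)) (F : L2TT) :
    Tendsto (fun n => S.V K a c (S.modulate K a d F n)) atTop (𝓝 0) := by
  have h := ((S.coordChange K a c).continuous.tendsto 0).comp
    (by simpa only [smul_zero] using (S.tendsto_avgFst_modulate K c hd
      (S.coordChange K c a F)).const_smul (S.coupling c : ℂ))
  rw [map_zero] at h
  refine h.congr fun n => ?_
  rw [V_apply, coordChange_modulate, Vown_apply, Function.comp_apply]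

/-! ### The three-particle band. -/

theorem Icc_subset_essentialSpectrum_H (K : Vec) (a : Fin 3) :
    (fun t : ℝ => (t : ℂ)) '' Icc (S.Emin K a) (S.Emax K a) ⊆ essentialSpectrum (S.H K a) := by
  rintro _ ⟨t, ht, rfl⟩
  refine mem_essentialSpectrum_of_weaklyNull (S.isSelfAdjoint_H K a) fun ε hε => ?_
  obtain ⟨x₀, hx₀, hEx₀⟩ := S.exists_E₃_eq K a ht
  let A : Set (Vec × Vec) := {x | |S.E₃ K a x - t| < ε / 2}
  have hA : IsOpen A :=
    isOpen_lt ((S.continuous_E₃ K a).sub continuous_const).abs continuous_const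
  have hApos := torusMeasure_prod_pos hA hx₀ (by simp [A, hEx₀, hε])
  let F : L2TT := indicatorConstLp 2 hA.measurableSet
    (measure_ne_top (torusMeasure.prod torusMeasure) A) (1 : ℂ)
  have hF : 0 < ‖F‖ := by
    rw [norm_indicatorConstLp (by norm_num) (by norm_num), norm_one, one_mul]
    exact Real.rpow_pos_of_pos (ENNReal.toReal_pos hApos.ne' (measure_ne_top _ _)) _
  -- Pairwise distinct frequencies make all three interactions vanish in the limit, so only the
  -- kinetic energy, within `ε / 2` of `t` on the support of `F`, remains.
  let d : Fin 3 → ℤ := ![0, 1, 2]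
  have hd : ∀ c : Fin 3, d (c + 1) ≠ d (c + 2) := by decide
  refine ⟨S.modulate K a d F, ‖F‖, hF, S.norm_modulate K a d F,
    S.weaklyNull_modulate K a (fun h => hd a h.2) F, ?_⟩
  have h1 := (tendsto_finsetSum Finset.univ fun c _ =>
    S.tendsto_V_modulate K a c (hd c) F).norm
  rw [Finset.sum_const_zero, norm_zero] at h1
  filter_upwards [h1.eventually_lt_const (show 0 < ε / 2 * ‖F‖ by positivity)] with n hn
  have h2 : ‖S.H₀ K a (S.modulate K a d F n) - (t : ℂ) • S.modulate K a d F n‖ ≤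
      ε / 2 * ‖F‖ := by
    refine L2_norm_le_of_ae_le ?_
    filter_upwards [Lp.coeFn_sub (S.H₀ K a (S.modulate K a d F n)) ((t : ℂ) • S.modulate K a d F n),
      S.H₀_apply K a (S.modulate K a d F n), Lp.coeFn_smul (t : ℂ) (S.modulate K a d F n),
      S.modulate_apply K a d F n, indicatorConstLp_coeFn (p := 2) (hs := hA.measurableSet)
        (hμs := measure_ne_top (torusMeasure.prod torusMeasure) A) (c := (1 : ℂ))]
      with x k1 k2 k3 k4 k5
    rw [k1, Pi.sub_apply, k2, k3, Pi.smul_apply, k4, smul_eq_mul, ← sub_mul, norm_mul, norm_mul,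
      norm_phase, one_mul, ← Complex.ofReal_sub, Complex.norm_real, Real.norm_eq_abs]
    by_cases hx : x ∈ A
    · exact mul_le_mul_of_nonneg_right (le_of_lt hx) (norm_nonneg _)
    · have : F x = 0 := k5.trans (indicator_of_notMem hx _)
      simp [this]
  have e : S.H K a (S.modulate K a d F n) - (t : ℂ) • S.modulate K a d F n =
      (S.H₀ K a (S.modulate K a d F n) - (t : ℂ) • S.modulate K a d F n)
        - ∑ c, S.V K a c (S.modulate K a d F n) := by
    rw [H_apply]; abel
  rw [e]
  refine (norm_sub_le _ _).trans ?_
  linarith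

/-! ### The two-particle branches. -/

lemma exists_nhds_abs_E₃_sub_lt (K : Vec) (b : Fin 3) (p₀ : Vec) {ε : ℝ} (hε : 0 < ε) :
    ∃ U, IsOpen U ∧ p₀ ∈ U ∧ ∀ p ∈ U, ∀ q ∈ torus,
      |S.E₃ K b (q, p) - S.E₃ K b (q, p₀)| ≤ ε := by
  have hc : IsCompact (Set.pi univ fun _ : Fin 3 => Icc (-π) π) :=
    isCompact_univ_pi fun _ => isCompact_Icc
  have h := hc.eventually_forall_of_forall_eventually (x₀ := p₀)
    (P := fun p q => |S.E₃ K b (q, p) - S.E₃ K b (q, p₀)| < ε) fun q _ => by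
      have hcont : Continuous fun z : Vec × Vec =>
          |S.E₃ K b (z.2, z.1) - S.E₃ K b (z.2, p₀)| :=
        (((S.continuous_E₃ K b).comp (by fun_prop)).sub
          ((S.continuous_E₃ K b).comp (by fun_prop))).abs
      exact hcont.continuousAt.eventually_lt continuousAt_const (by simpa using hε)
  obtain ⟨U, hU, hUo, hpU⟩ := eventually_nhds_iff.1 h
  exact ⟨U, hUo, hpU, fun p hp q hq => (hU p hp q fun i _ => Ioc_subset_Icc_self (hq i trivial)).le⟩

lemma phase_single (K : Vec) (b : Fin 3) (n : ℕ) (x : Vec × Vec) :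
    S.phase K b (Pi.single b 1) n x =
      Complex.exp ((n * (S.m b * K 0 - x.2 0) : ℝ) * Complex.I) := by
  rw [phase_eq, Pi.single_eq_same, Pi.single_eq_of_ne (fin3_cyc b).1,
    Pi.single_eq_of_ne (fin3_cyc b).2.1]
  simp

/-- The phase of the particle `b` depends on `p` alone and commutes with averaging over `q`. The
eigenvalue equation at `p₀` then cancels everything except the variation of the energy between `p`
and `p₀`, which is at most `ε` on the support of `F`. -/
lemma norm_H_sub_modulate_le (K : Vec) (b : Fin 3) (p₀ : Vec) {z : ℂ} {g : L2T}
    (hg : S.h b ((S.m (b + 1) + S.m (b + 2)) • K + p₀) g = z • g) {ε : ℝ} {U : Set Vec}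
    (hU : ∀ p ∈ U, ∀ q ∈ torus, |S.E₃ K b (q, p) - S.E₃ K b (q, p₀)| ≤ ε) {F : L2TT}
    (hF : F =ᵐ[torusMeasure.prod torusMeasure] fun x => g x.1 * U.indicator 1 x.2) (n : ℕ) :
    ‖S.H₀ K b (S.modulate K b (Pi.single b 1) F n)
      - S.Vown b (S.modulate K b (Pi.single b 1) F n)
      - (z + (S.eps b (S.m b • K - p₀) : ℂ)) • S.modulate K b (Pi.single b 1) F n‖
        ≤ ε * ‖F‖ := by
  set k := (S.m (b + 1) + S.m (b + 2)) • K + p₀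
  set f := S.modulate K b (Pi.single b 1) F n
  have hgq : ∀ᵐ q ∂torusMeasure, (S.E₂ b k q : ℂ) * g q
      - (S.coupling b : ℂ) * ∫ q', g q' ∂torusMeasure = z * g q := by
    have h0 : (S.h b k g : Vec → ℂ) =ᵐ[torusMeasure] (z • g : L2T) := by rw [hg]
    rw [h_apply] at h0
    filter_upwards [h0, Lp.coeFn_sub (mulOp (S.E₂ b k) (S.continuous_E₂ b k).measurable
      (S.exists_E₂_le b k) g) ((S.coupling b : ℂ) • avg g),
      mulOp_apply (S.E₂ b k) (S.continuous_E₂ b k).measurable (S.exists_E₂_le b k) g,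
      Lp.coeFn_smul (S.coupling b : ℂ) (avg g), avg_apply g, Lp.coeFn_smul z g]
      with q h0 h1 h2 h3 h4 h5
    rw [h1, Pi.sub_apply, h2, h3, Pi.smul_apply, h4, h5] at h0
    exact h0
  have hfe := S.modulate_apply K b (Pi.single b 1) F n
  refine L2_norm_le_of_ae_le ?_
  rw [Vown_apply]
  filter_upwards [Lp.coeFn_sub (S.H₀ K b f - (S.coupling b : ℂ) • avgFst f)
      ((z + (S.eps b (S.m b • K - p₀) : ℂ)) • f),
    Lp.coeFn_sub (S.H₀ K b f) ((S.coupling b : ℂ) • avgFst f), S.H₀_apply K b f,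
    Lp.coeFn_smul (S.coupling b : ℂ) (avgFst f), avgFst_apply f,
    Lp.coeFn_smul (z + (S.eps b (S.m b • K - p₀) : ℂ)) f, hfe, hF, ae_slice hfe, ae_slice hF,
    Measure.quasiMeasurePreserving_fst.ae hgq, ae_mem_torus_prod]
    with x h1 h2 h3 h4 h5 h6 h7 h8 h9 h10 h11 h12
  have hint : ∫ q, f (q, x.2) ∂torusMeasure = S.phase K b (Pi.single b 1) n x
      * U.indicator 1 x.2 * ∫ q, g q ∂torusMeasure := by
    rw [← integral_const_mul]
    refine integral_congr_ae ?_
    filter_upwards [h9, h10] with q k1 k2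
    rw [k1, k2, phase_single, phase_single]
    dsimp only
    ring
  have hE : (S.E₂ b k x.1 : ℂ) = S.E₃ K b (x.1, p₀) - S.eps b (S.m b • K - p₀) := by
    rw [E₃_eq_E₂]; push_cast; ring
  rw [hE] at h11
  have e : (S.H₀ K b f - (S.coupling b : ℂ) • avgFst f
      - (z + (S.eps b (S.m b • K - p₀) : ℂ)) • f : L2TT) x =
      ((S.E₃ K b (x.1, x.2) - S.E₃ K b (x.1, p₀) : ℝ) : ℂ)
        * (S.phase K b (Pi.single b 1) n x * F x) := by
    rw [h1, Pi.sub_apply, h2, Pi.sub_apply, h3, h4, Pi.smul_apply, h5, hint, h6, Pi.smul_apply, h7,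
      h8, smul_eq_mul, smul_eq_mul]
    push_cast
    linear_combination (S.phase K b (Pi.single b 1) n x * U.indicator 1 x.2) * h11
  rw [e, norm_mul, norm_mul, norm_phase, one_mul, Complex.norm_real, Real.norm_eq_abs]
  by_cases hx : x.2 ∈ U
  · exact mul_le_mul_of_nonneg_right (hU _ hx _ h12.1) (norm_nonneg _)
  · have : F x = 0 := by rw [h8, indicator_of_notMem hx, mul_zero]
    simp [this]

theorem add_eps_mem_essentialSpectrum_H (K : Vec) (a b : Fin 3) {p₀ : Vec} (hp₀ : p₀ ∈ torus)
    {z : ℂ} (hz : z ∈ discreteSpectrum (S.h b ((S.m (b + 1) + S.m (b + 2)) • K + p₀))) :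
    z + (S.eps b (S.m b • K - p₀) : ℂ) ∈ essentialSpectrum (S.H K a) := by
  obtain ⟨g, hg, hg0⟩ := hz.2.1.exists_hasEigenvector
  rw [Module.End.mem_eigenspace_iff, ContinuousLinearMap.coe_coe] at hg
  refine mem_essentialSpectrum_of_weaklyNull (S.isSelfAdjoint_H K a) fun ε hε => ?_
  obtain ⟨U, hUo, hpU, hU⟩ := S.exists_nhds_abs_E₃_sub_lt K b p₀ (half_pos hε)
  have hFm : MemLp (fun x : Vec × Vec => g x.1 * U.indicator 1 x.2) 2
      (torusMeasure.prod torusMeasure) := by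
    refine ((Lp.memLp g).comp_fst torusMeasure).of_le ?_ (Eventually.of_forall fun x => ?_)
    · exact (Lp.aestronglyMeasurable g).comp_fst.mul
        (((measurable_one.indicator hUo.measurableSet).comp measurable_snd).aestronglyMeasurable)
    · by_cases hx : x.2 ∈ U <;> simp [hx]
  set F : L2TT := hFm.toLp _
  have hF : 0 < ‖F‖ := by
    have h1 : ‖F‖ ^ 2 = ‖g‖ ^ 2 * torusMeasure.real U := by
      have h2 : (fun x => ‖F x‖ ^ 2) =ᵐ[torusMeasure.prod torusMeasure]
          fun x => ‖g x.1‖ ^ 2 * U.indicator 1 x.2 := by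
        filter_upwards [hFm.coeFn_toLp] with x hx
        rw [hx]
        by_cases hxU : x.2 ∈ U <;> simp [hxU]
      rw [L2_norm_sq, L2_norm_sq, integral_congr_ae h2,
        integral_prod_mul (fun q => ‖g q‖ ^ 2) (fun p => U.indicator (1 : Vec → ℝ) p),
        integral_indicator_one hUo.measurableSet]
    have h3 : 0 < torusMeasure.real U :=
      ENNReal.toReal_pos (torusMeasure_pos hUo hp₀ hpU).ne' (measure_ne_top _ _)
    have h4 : 0 < ‖F‖ ^ 2 := by
      rw [h1]; exact mul_pos (pow_pos (norm_pos_iff.2 hg0) 2) h3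
    exact (sq_pos_iff.1 h4).symm.lt_of_le (norm_nonneg _)
  let d : Fin 3 → ℤ := Pi.single b 1
  -- For `c ≠ b` exactly one of `c + 1`, `c + 2` equals `b`. For `c = b` neither does, and `V_b`
  -- survives, as the bound state requires.
  have hd : ∀ c, c ≠ b → d (c + 1) ≠ d (c + 2) := by
    have : ∀ b c : Fin 3, c ≠ b →
        (Pi.single b 1 : Fin 3 → ℤ) (c + 1) ≠ (Pi.single b 1 : Fin 3 → ℤ) (c + 2) := by decide
    exact this b
  have hw : WeaklyNull (S.modulate K b d F) := S.weaklyNull_modulate K b (fun h => by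
    have h1 := h.1
    simp [d] at h1) F
  -- The sequence is built in the coordinates of the pair `b`, where the eigenfunction lives, and
  -- carried isometrically to those of `a`.
  refine ⟨fun n => S.coordChange K a b (S.modulate K b d F n), ‖F‖, hF, fun n => ?_, hw.map _, ?_⟩
  · rw [norm_coordChange, norm_modulate]
  have h1 := ((S.tendsto_V_modulate K b (b + 1) (hd _ (fin3_cyc b).1) F).add
    (S.tendsto_V_modulate K b (b + 2) (hd _ (fin3_cyc b).2.1) F)).norm
  rw [add_zero, norm_zero] at h1
  filter_upwards [h1.eventually_lt_const (show 0 < ε / 2 * ‖F‖ by positivity)] with n hn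
  rw [← coordChange_H, ← map_smul, ← map_sub, norm_coordChange]
  have h2 := S.norm_H_sub_modulate_le K b p₀ hg hU hFm.coeFn_toLp n
  set f := S.modulate K b d F n
  have e : S.H K b f - (z + (S.eps b (S.m b • K - p₀) : ℂ)) • f =
      (S.H₀ K b f - S.Vown b f - (z + (S.eps b (S.m b • K - p₀) : ℂ)) • f)
        - (S.V K b (b + 1) f + S.V K b (b + 2) f) := by
    rw [H_apply, sum_fin3 _ b, V_self]; abel
  rw [e]
  refine (norm_sub_le _ _).trans ?_
  have h3 : ‖S.H₀ K b f - S.Vown b f - (z + (S.eps b (S.m b • K - p₀) : ℂ)) • f‖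
      ≤ ε / 2 * ‖F‖ := h2
  linarith

end System

end LatticeThreeBody

theorem mainTheorem2 (S : LatticeThreeBody.System) (a : Fin 3)
    (K : LatticeThreeBody.Vec) (hK : K ∈ LatticeThreeBody.torus) :
    LatticeThreeBody.essentialSpectrum (S.H K a) =
      (⋃ b : Fin 3, ⋃ p ∈ LatticeThreeBody.torus,
        (fun z : ℂ => z + (S.eps b (S.m b • K - p) : ℂ)) ''
          LatticeThreeBody.discreteSpectrum
            (S.h b ((S.m (b + 1) + S.m (b + 2)) • K + p))) ∪
      (fun t : ℝ => (t : ℂ)) '' Set.Icc (S.Emin K a) (S.Emax K a) := by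
  refine Set.Subset.antisymm (S.essentialSpectrum_H_subset K a)
    (Set.union_subset ?_ (S.Icc_subset_essentialSpectrum_H K a))
  refine Set.iUnion_subset fun b => Set.iUnion₂_subset fun p hp => ?_
  rintro _ ⟨z, hz, rfl⟩
  exact S.add_eps_mem_essentialSpectrum_H K a b hp hz
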